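/- Let $n\ge 1$, $0<\xi_1<\dots<\xi_n=1$, $g_1,\dots,g_n>0$, and $g=\sum_{i=1}^n g_i\delta_{\xi_i}$. For $z\in\mathbb C$ consider the equation $$-\phi_{\xi\xi\xi}=z\,g\,\phi$$ in the sense of distributions on $(0,\infty)$, for continuous $\phi:[0,\infty)\to\mathbb C$ (the string is continued without mass to the right of $1$; derivatives are right-hand derivatives, so that $\phi_{\xi\xi}(1)$ means $\phi_{\xi\xi}(1+0)$). For $a=0,1,2$, a number $z\in\mathbb C$ belongs to the spectrum of type $a$ if there is a solution $\phi$, not identically zero on $[0,1]$, with $$\phi(0)=\phi_\xi(0)=0\quad\text{and}\quad \phi(1)=0\ (a=0),\qquad \phi_\xi(1)=0\ (a=1),\qquad \phi_{\xi\xi}(1)=0\ (a=2).$$ Put $(f,h)_g=\int_{[0,1]}f h\,dg=\sum_{i=1}^n g_i f(\xi_i)h(\xi_i)$. Then the following hold. For every $z\in\mathbb C$ there is a unique solution $\phi(\cdot;z)$ with $\phi(0)=\phi_\xi(0)=0$, $\phi_{\xi\xi}(0)=1$, and the spectra of types $0,1,2$ are the zero sets of $z\mapsto\phi(1;z)$,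 $\phi_\xi(1;z)$, $\phi_{\xi\xi}(1;z)$ respectively. 1. All three spectra consist of positive real numbers and are simple: each eigenfunction is unique on $[0,1]$ up to a scalar factor, and each eigenvalue is a simple zero of the corresponding function $\phi(1;z)$, $\phi_\xi(1;z)$ or $\phi_{\xi\xi}(1;z)$. The spectra of types $0$ and $1$ have exactly $n-1$ points each, and the spectrum of type $2$ has exactly $n$ points. 2. If $z_{a,1}<z_{a,2}<\cdots$ denote the points of the spectrum of type $a$, then $$0<z_{2,1}<z_{1,1}<z_{0,1}<\dots<z_{2,n-1}<z_{1,n-1}<z_{0,n-1}<z_{2,n}.$$ 3. The eigenfunctions $\phi_{2,j}(\xi)=\phi(\xi;z_{2,j})$, $j=1,\dots,n$, satisfy $$(\phi_{2,i},\phi_{2,j})_g=\frac{\phi_{2,i,\xi}(1)\,\phi_{2,j,\xi}(1)}{z_{2,i}+z_{2,j}},\qquad 1\le i,j\le n,$$ and they are linearly independent in $L^2([0,1],g)$. -/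

import Mathlib

open scoped ContDiff

noncomputable section

namespace CubicString

/-- The discrete mass distribution `g = ∑ i, m i • δ_{ξ i}`, as a measure on the line. -/
def massMeasure {n : ℕ} (m ξ : Fin n → ℝ) : MeasureTheory.Measure ℝ :=
  ∑ i, ENNReal.ofReal (m i) • MeasureTheory.Measure.dirac (ξ i)

/-- The right-hand derivative. For the functions below (which are piecewise quadratic on `[0, ∞)`
with a continuous derivative) `rightDeriv φ` is `φ_ξ`, and `rightDeriv (rightDeriv φ)` is `φ_ξξ`,
taken as a right-hand limit at the point masses. -/
def rightDeriv (φ : ℝ → ℂ) (x : ℝ) : ℂ := derivWithin φ (Set.Ioi x) x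

/-- `-φ_ξξξ = z g φ` in the sense of distributions on `(0, ∞)`, for `φ` continuous on `[0, ∞)`.
The measure `g` has all its mass in `(0, 1]`; to the right of `1` the string is continued without
mass, so that right-hand limits at `1` are available even if `g` has a point mass there. Only the
values of `φ` on `[0, ∞)` matter. -/
structure IsSolution (g : MeasureTheory.Measure ℝ) (z : ℂ) (φ : ℝ → ℂ) : Prop where
  continuousOn : ContinuousOn φ (Set.Ici 0)
  weak_eq : ∀ η : ℝ → ℝ, ContDiff ℝ ∞ η → HasCompactSupport η → tsupport η ⊆ Set.Ioi 0 →
    ∫ x, ((iteratedDeriv 3 η x : ℝ) : ℂ) * φ x = z * ∫ x, (η x : ℂ) * φ x ∂g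

/-- The solution of the initial value problem `φ(0) = φ_ξ(0) = 0`, `φ_ξξ(0) = 1`. -/
structure IsIVPSolution (g : MeasureTheory.Measure ℝ) (z : ℂ) (φ : ℝ → ℂ) : Prop extends
    IsSolution g z φ where
  zero : φ 0 = 0
  deriv_zero : rightDeriv φ 0 = 0
  deriv2_zero : rightDeriv (rightDeriv φ) 0 = 1

/-- The quantity that vanishes in the boundary condition at `1`: `φ(1)` for type 0,
`φ_ξ(1)` for type 1, `φ_ξξ(1)` (a right-hand limit) for type 2. -/
def endValue (a : Fin 3) (φ : ℝ → ℂ) : ℂ :=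
  match a with
  | 0 => φ 1
  | 1 => rightDeriv φ 1
  | 2 => rightDeriv (rightDeriv φ) 1

/-- `φ` is an eigenfunction, with eigenvalue `z`, of the boundary value problem of type `a`. -/
structure IsEigenfunction (g : MeasureTheory.Measure ℝ) (a : Fin 3) (z : ℂ) (φ : ℝ → ℂ) : Prop
    extends IsSolution g z φ where
  zero : φ 0 = 0
  deriv_zero : rightDeriv φ 0 = 0
  endValue_eq : endValue a φ = 0
  ne_zero : ∃ x ∈ Set.Icc (0 : ℝ) 1, φ x ≠ 0

/-- The spectrum (all complex eigenvalues) of the boundary value problem of type `a`. -/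
def eigenvalues (g : MeasureTheory.Measure ℝ) (a : Fin 3) : Set ℂ :=
  {z | ∃ φ, IsEigenfunction g a z φ}

/-- The bilinear form `(f, h)_g`, the integral of `f h` over `[0, 1]` against `g`. -/
def form (g : MeasureTheory.Measure ℝ) (f h : ℝ → ℂ) : ℂ :=
  ∫ x in Set.Icc (0 : ℝ) 1, f x * h x ∂g

end CubicString

end

/-! Since `(x - a)₊² / 2` is a fundamental solution of the third derivative, the weak equation on
`(0, ∞)` says exactly that `φ` is a `C¹` piecewise quadratic spline whose second derivative jumps by
`-z g_i φ(ξ_i)` at each mass (`IsSolution.exists_eqOn_spline`, `isSolution_of_eqOn_spline`). With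
`φ(0) = φ_ξ(0) = 0` the values at the nodes are determined one after another, so the solution is
unique up to the factor `φ_ξξ(0)`. Its data `(p, q, r) = (φ, φ_ξ, φ_ξξ)` at the nodes are
polynomials in `z`, given by the recursion `states`.

Spectral positivity, simplicity, counting and interlacing are one statement, proved by induction on
the number of masses (`Interlacing.step`). Crossing a gap `l` and a mass `g` replaces `q` by `q' = q
+ l r`, `p` by `p' = p + l q + (l² / 2) r`, and `r` by `r' = r - z g p'`. The old interlacing fixes
enough signs to locate as many positive roots as the degree allows. Each polynomial is then a
constant times a product of distinct real linear factors, so there are no other complex roots and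
every root is simple.

The pairing formula is the Lagrange identity `sum_nodeValue_mul_nodeValue` with vanishing curvatures
at `1`. It shows that type 2 eigenfunctions need not be orthogonal; their independence comes from a
matrix having their node vectors as eigenvectors with distinct eigenvalues `1 / z_j`. -/

namespace CubicString

/-! ### Real-rooted polynomials and interlacing. -/

open Polynomial

/-- The polynomial `A ∏ (a i - X)`, over `i < n`. -/
noncomputable def rootPoly (A : ℝ) (a : ℕ → ℝ) (n : ℕ) : ℝ[X] :=
  C A * ∏ i ∈ Finset.range n, (C (a i) - X)

theorem rootPoly_eval (A : ℝ) (a : ℕ → ℝ) (n : ℕ) (x : ℝ) :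
    (rootPoly A a n).eval x = A * ∏ i ∈ Finset.range n, (a i - x) := by
  simp [rootPoly, eval_prod]

theorem rootPoly_natDegree_le (A : ℝ) (a : ℕ → ℝ) (n : ℕ) :
    (rootPoly A a n).natDegree ≤ n := by
  refine (natDegree_C_mul_le _ _).trans ((natDegree_prod_le _ _).trans ?_)
  refine (Finset.sum_le_card_nsmul _ _ 1 fun i _ => ?_).trans (by simp)
  exact (natDegree_sub_le _ _).trans (by simp)

theorem rootPoly_coeff (A : ℝ) (a : ℕ → ℝ) (n : ℕ) :
    (rootPoly A a n).coeff n = A * (-1) ^ n := by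
  rw [rootPoly, coeff_C_mul]
  congr 1
  have h := coeff_prod_of_natDegree_le (s := Finset.range n) (f := fun i => C (a i) - X) 1
    fun i _ => (natDegree_sub_le _ _).trans (by simp)
  simpa using h

/-- The sign of `A ∏ (a i - X)` between two consecutive roots. -/
theorem rootPoly_sign {A : ℝ} (hA : 0 < A) {a : ℕ → ℝ} {n k : ℕ} (hk : k ≤ n) {x : ℝ}
    (h₁ : ∀ i < k, a i < x) (h₂ : ∀ i, k ≤ i → i < n → x < a i) :
    0 < (-1) ^ k * (rootPoly A a n).eval x := by
  obtain ⟨d, rfl⟩ := Nat.exists_eq_add_of_le hk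
  rw [rootPoly_eval, Finset.prod_range_add]
  have e : (-1 : ℝ) ^ k * ∏ i ∈ Finset.range k, (a i - x) =
      ∏ i ∈ Finset.range k, (x - a i) := by
    have := Finset.prod_neg (s := Finset.range k) (fun i => a i - x)
    simp only [neg_sub, Finset.card_range] at this
    exact this.symm
  have e1 : 0 < ∏ i ∈ Finset.range k, (x - a i) :=
    Finset.prod_pos fun i hi => sub_pos.2 (h₁ i (Finset.mem_range.1 hi))
  have e2 : 0 < ∏ i ∈ Finset.range d, (a (k + i) - x) :=
    Finset.prod_pos fun i hi =>
      sub_pos.2 (h₂ _ (by omega) (by have := Finset.mem_range.1 hi; omega))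
  calc 0 < A * ((∏ i ∈ Finset.range k, (x - a i)) * ∏ i ∈ Finset.range d, (a (k + i) - x)) := by
        positivity
    _ = _ := by rw [← e]; ring

/-- Both sides have degree at most `n` and agree at the `n + 1` points `0, s 0, …, s (n - 1)`. The
value at `0` fixes the constant. -/
theorem eq_rootPoly {f : ℝ[X]} {n : ℕ} (hf : f.natDegree ≤ n) {s : ℕ → ℝ}
    (hs : ∀ i < n, 0 < s i) (hinj : ∀ i < n, ∀ j < n, i < j → s i < s j)
    (hroot : ∀ i < n, f.eval (s i) = 0) (h0 : 0 < f.eval 0) :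
    ∃ A : ℝ, 0 < A ∧ f = rootPoly A s n := by
  have hP : 0 < ∏ i ∈ Finset.range n, s i :=
    Finset.prod_pos fun i hi => hs i (Finset.mem_range.1 hi)
  refine ⟨f.eval 0 / ∏ i ∈ Finset.range n, s i, div_pos h0 hP, ?_⟩
  have hinj' : Set.InjOn s (Finset.range n) := by
    intro i hi j hj hij
    have hi := Finset.mem_range.1 (Finset.mem_coe.1 hi)
    have hj := Finset.mem_range.1 (Finset.mem_coe.1 hj)
    rcases lt_trichotomy i j with h | h | h
    · exact absurd hij (hinj i hi j hj h).ne
    · exact h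
    · exact absurd hij (hinj j hj i hi h).ne'
  have h0n : (0 : ℝ) ∉ (Finset.range n).image s := by
    simp only [Finset.mem_image, Finset.mem_range, not_exists, not_and]
    exact fun i hi => (hs i hi).ne'
  have hcard : (insert 0 ((Finset.range n).image s)).card = n + 1 := by
    rw [Finset.card_insert_of_notMem h0n, Finset.card_image_of_injOn hinj', Finset.card_range]
  have hd : ∀ g : ℝ[X], g.natDegree ≤ n →
      g.degree < (insert 0 ((Finset.range n).image s)).card := fun g hg => by
    rw [hcard]
    exact (degree_le_of_natDegree_le hg).trans_lt (by exact_mod_cast Nat.lt_succ_self n)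
  refine eq_of_degrees_lt_of_eval_finset_eq _ (hd _ hf) (hd _ (rootPoly_natDegree_le _ _ _)) ?_
  intro x hx
  rcases Finset.mem_insert.1 hx with rfl | hx
  · rw [rootPoly_eval]
    simp only [sub_zero]
    field_simp
  · obtain ⟨i, hi, rfl⟩ := Finset.mem_image.1 hx
    rw [hroot i (Finset.mem_range.1 hi), rootPoly_eval,
      Finset.prod_eq_zero (f := fun j => s j - s i) hi (sub_self _), mul_zero]

/-- The leading coefficient decides the sign near `+∞`. This supplies the last root, which has no
old root to its right to bound it. -/
theorem exists_sign_gt {f : ℝ[X]} {N : ℕ} (hN : N ≠ 0) (hd : f.natDegree ≤ N)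
    (hc : 0 < (-1) ^ N * f.coeff N) (x : ℝ) : ∃ y, x < y ∧ 0 < (-1) ^ N * f.eval y := by
  have hne : f.coeff N ≠ 0 := fun h => by simp [h] at hc
  have hdeg : f.natDegree = N := le_antisymm hd (le_natDegree_of_ne_zero hne)
  have hu : ((-1 : ℝ) ^ N) ≠ 0 := by simp
  have ht := tendsto_atTop_of_leadingCoeff_nonneg (C ((-1 : ℝ) ^ N) * f)
    (by
      rw [degree_C_mul hu]
      exact natDegree_pos_iff_degree_pos.1 (by omega))
    (by
      rw [leadingCoeff_mul, leadingCoeff_C, leadingCoeff, hdeg]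
      exact hc.le)
  obtain ⟨y, hy1, hy2⟩ := ((ht.eventually_gt_atTop 0).and (Filter.eventually_gt_atTop x)).exists
  exact ⟨y, hy2, by simpa using hy1⟩

theorem exists_root_between {f : ℝ[X]} {k : ℕ} {x y : ℝ} (hxy : x < y)
    (hx : 0 < (-1) ^ k * f.eval x) (hy : 0 < (-1) ^ (k + 1) * f.eval y) :
    ∃ t, x < t ∧ t < y ∧ f.eval t = 0 := by
  have hcont : ContinuousOn (fun t => (-1) ^ k * f.eval t) (Set.Icc x y) := by fun_prop
  obtain ⟨t, ht, h0⟩ := intermediate_value_Icc' hxy.le hcont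
    (show (0 : ℝ) ∈ Set.Icc _ _ from ⟨by rw [pow_succ] at hy; linarith, hx.le⟩)
  have h0' : f.eval t = 0 := by simpa using h0
  refine ⟨t, lt_of_le_of_ne ht.1 ?_, lt_of_le_of_ne ht.2 ?_, h0'⟩
  · rintro rfl; simp [h0'] at hx
  · rintro rfl; simp [h0'] at hy

/-- `p`, `q`, `r` have positive simple roots `c`, `b`, `a` (and no others) which interlace as
`a 0 < b 0 < c 0 < a 1 < ⋯ < c (n - 1) < a n`, and are positive at `0`. -/
structure Interlacing (n : ℕ) (p q r : ℝ[X]) (a b c : ℕ → ℝ) : Prop where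
  hr : ∃ A, 0 < A ∧ r = rootPoly A a (n + 1)
  hq : ∃ A, 0 < A ∧ q = rootPoly A b n
  hp : ∃ A, 0 < A ∧ p = rootPoly A c n
  pos : 0 < a 0
  lt : ∀ i < n, a i < b i ∧ b i < c i ∧ c i < a (i + 1)

theorem Interlacing.mono {n : ℕ} {p q r : ℝ[X]} {a b c : ℕ → ℝ} (H : Interlacing n p q r a b c)
    {i j : ℕ} (hij : i ≤ j) (hj : j ≤ n) : a i ≤ a j := by
  induction j, hij using Nat.le_induction with
  | base => exact le_rfl
  | succ j hij ih =>
    obtain ⟨h1, h2, h3⟩ := H.lt j (by omega)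
    linarith [ih (by omega)]

theorem rootPoly_eval_zero_pos {A : ℝ} (hA : 0 < A) {a : ℕ → ℝ} {n : ℕ}
    (h : ∀ i < n, 0 < a i) : 0 < (rootPoly A a n).eval 0 := by
  simpa using rootPoly_sign hA (Nat.zero_le n) (by simp) fun i _ hi => h i hi

set_option maxHeartbeats 1000000 in
/-- The effect of a massless interval of length `l` followed by a point mass `g`. -/
theorem Interlacing.step {n : ℕ} {p q r : ℝ[X]} {a b c : ℕ → ℝ} (H : Interlacing n p q r a b c)
    {l g : ℝ} (hl : 0 < l) (hg : 0 < g) :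
    ∃ a' b' c', Interlacing (n + 1) (p + C l * q + C (l ^ 2 / 2) * r) (q + C l * r)
      (r - X * (C g * (p + C l * q + C (l ^ 2 / 2) * r))) a' b' c' := by
  obtain ⟨A, hA, hr⟩ := H.hr
  obtain ⟨B, hB, hq⟩ := H.hq
  obtain ⟨D, hD, hp⟩ := H.hp
  have hapos : ∀ i ≤ n, 0 < a i := fun i hi => H.pos.trans_le (H.mono (Nat.zero_le i) hi)
  -- signs of `r`, `q`, `p` between their roots
  have sr : ∀ k ≤ n, ∀ x, a k < x → (k < n → x < a (k + 1)) →
      0 < (-1) ^ (k + 1) * r.eval x := by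
    intro k hk x h1 h2
    rw [hr]
    refine rootPoly_sign hA (by omega) (fun i hi => ?_) (fun i hi hi' => ?_)
    · exact (H.mono (by omega) hk).trans_lt h1
    · exact (h2 (by omega)).trans_le (H.mono hi (by omega))
  have sp : ∀ k ≤ n, ∀ x, a k ≤ x → (k < n → x < c k) → 0 < (-1) ^ k * p.eval x := by
    intro k hk x h1 h2
    rw [hp]
    refine rootPoly_sign hD hk (fun i hi => ?_) (fun i hi hi' => ?_)
    · exact ((H.lt i (by omega)).2.2.trans_le (H.mono (by omega) hk)).trans_le h1
    · rcases eq_or_lt_of_le hi with rfl | hi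
      · exact h2 hi'
      · have := (H.lt k (by omega)).2.2
        have h3 := H.mono (i := k + 1) (j := i) (by omega) (by omega)
        have h4 := H.lt i hi'
        linarith [h2 (by omega), h4.1, h4.2.1]
  have sq : ∀ k ≤ n, ∀ x, (∀ i < k, b i < x) → (∀ i, k ≤ i → i < n → x < b i) →
      0 < (-1) ^ k * q.eval x := by
    intro k hk x h1 h2
    rw [hq]
    exact rootPoly_sign hB hk h1 h2
  have sqa : ∀ k ≤ n, 0 < (-1) ^ k * q.eval (a k) := fun k hk =>
    sq k hk _ (fun i hi => by
        have := H.lt i (by omega)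
        linarith [H.mono (i := i + 1) (j := k) (by omega) hk])
      (fun i hi hi' => (H.mono hi (by omega)).trans_lt (H.lt i hi').1)
  have ra : ∀ k ≤ n, r.eval (a k) = 0 := fun k hk => by
    rw [hr, rootPoly_eval, Finset.prod_eq_zero (Finset.mem_range.2 (Nat.lt_succ_of_le hk))
      (sub_self _), mul_zero]
  have qb : ∀ k < n, q.eval (b k) = 0 := fun k hk => by
    rw [hq, rootPoly_eval, Finset.prod_eq_zero (Finset.mem_range.2 hk) (sub_self _), mul_zero]
  have pc : ∀ k < n, p.eval (c k) = 0 := fun k hk => by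
    rw [hp, rootPoly_eval, Finset.prod_eq_zero (Finset.mem_range.2 hk) (sub_self _), mul_zero]
  have sqc : ∀ k < n, 0 < (-1) ^ (k + 1) * q.eval (c k) := fun k hk =>
    sq (k + 1) hk _ (fun i hi => by
        have h1 := H.lt i (by omega)
        have h2 := H.lt k (by omega)
        have := H.mono (i := i) (j := k) (by omega) (by omega)
        rcases eq_or_lt_of_le (Nat.lt_succ_iff.1 hi) with rfl | h
        · linarith
        · linarith [H.mono (i := i + 1) (j := k) (by omega) (by omega)])
      (fun i hi hi' => by
        have h1 := H.lt i (by omega)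
        have h2 := H.lt k (by omega)
        linarith [H.mono (i := k + 1) (j := i) (by omega) (by omega)])
  set q' := q + C l * r with hq'
  set p' := p + C l * q + C (l ^ 2 / 2) * r with hp'
  set r' := r - X * (C g * p') with hr'
  clear_value r' p' q'
  have eq' : ∀ x, q'.eval x = q.eval x + l * r.eval x := fun x => by simp [hq']
  have ep' : ∀ x, p'.eval x = p.eval x + l * q.eval x + l ^ 2 / 2 * r.eval x := fun x => by
    simp [hp']
  have er' : ∀ x, r'.eval x = r.eval x - x * (g * p'.eval x) := fun x => by simp [hr']
  have dr : r.natDegree ≤ n + 1 := hr ▸ rootPoly_natDegree_le _ _ _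
  have dq : q.natDegree ≤ n := hq ▸ rootPoly_natDegree_le _ _ _
  have dp : p.natDegree ≤ n := hp ▸ rootPoly_natDegree_le _ _ _
  have dq' : q'.natDegree ≤ n + 1 := hq' ▸
    natDegree_add_le_of_degree_le (by omega) ((natDegree_C_mul_le _ _).trans dr)
  have dp' : p'.natDegree ≤ n + 1 := hp' ▸
    natDegree_add_le_of_degree_le (natDegree_add_le_of_degree_le (by omega)
      ((natDegree_C_mul_le _ _).trans (by omega))) ((natDegree_C_mul_le _ _).trans dr)
  have dr' : r'.natDegree ≤ n + 2 := by
    rw [hr']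
    refine (natDegree_sub_le_of_le (m := n + 2) (n := n + 2) (by omega) ?_).trans (max_self _).le
    refine natDegree_mul_le.trans ?_
    have := natDegree_C_mul_le g p'
    rw [natDegree_X]
    omega
  have cr : r.coeff (n + 1) = A * (-1) ^ (n + 1) := hr ▸ rootPoly_coeff _ _ _
  have cq' : q'.coeff (n + 1) = l * (A * (-1) ^ (n + 1)) := by
    rw [hq', coeff_add, coeff_C_mul, cr, coeff_eq_zero_of_natDegree_lt (by omega), zero_add]
  have cp' : p'.coeff (n + 1) = l ^ 2 / 2 * (A * (-1) ^ (n + 1)) := by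
    rw [hp', coeff_add, coeff_add, coeff_C_mul, coeff_C_mul, cr,
      coeff_eq_zero_of_natDegree_lt (by omega), coeff_eq_zero_of_natDegree_lt (by omega)]
    ring
  have cr' : r'.coeff (n + 2) = - (g * (l ^ 2 / 2 * (A * (-1) ^ (n + 1)))) := by
    rw [hr', coeff_sub, coeff_X_mul, coeff_C_mul, cp', coeff_eq_zero_of_natDegree_lt (by omega),
      zero_sub]
  have one : ∀ k : ℕ, (-1 : ℝ) ^ k * (-1) ^ k = 1 := fun k => by
    rw [← mul_pow]; simp
  -- the roots of `q'`
  have Hb : ∀ j, ∃ t, j ≤ n → a j < t ∧ (j < n → t < b j) ∧ q'.eval t = 0 := by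
    intro j
    by_cases hj : j ≤ n
    swap
    · exact ⟨0, fun h => absurd h hj⟩
    -- At a root of `r`, `q'` equals `q`; at a root of `q` it equals `l r`. The signs are opposite
    -- at `a j` and `b j`.
    have h1 : 0 < (-1) ^ j * q'.eval (a j) := by
      rw [eq', ra j hj, mul_zero, add_zero]
      exact sqa j hj
    rcases eq_or_lt_of_le hj with rfl | hj'
    · obtain ⟨y, hy, hy'⟩ := exists_sign_gt (N := j + 1) (by omega) dq' (by
        rw [cq']
        calc 0 < l * A := by positivity
          _ = l * A * ((-1) ^ (j + 1) * (-1) ^ (j + 1)) := by rw [one, mul_one]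
          _ = _ := by ring) (a j)
      obtain ⟨t, ht, -, h0⟩ := exists_root_between hy h1 hy'
      exact ⟨t, fun _ => ⟨ht, fun h => absurd h (lt_irrefl _), h0⟩⟩
    · have hlt := H.lt j hj'
      obtain ⟨t, ht, ht', h0⟩ := exists_root_between (f := q') hlt.1 h1 (by
        rw [eq', qb j hj', zero_add]
        have := mul_pos hl (sr j hj _ hlt.1 fun _ => by linarith)
        linarith)
      exact ⟨t, fun _ => ⟨ht, fun _ => ht', h0⟩⟩
  choose b' hb' using Hb
  -- the roots of `p'`
  have spb : ∀ j ≤ n, 0 < (-1) ^ j * p'.eval (b' j) := by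
    intro j hj
    obtain ⟨h1, h2, h3⟩ := hb' j hj
    -- Where `q' = 0` one has `q = -l r`, which eliminates `q`; the two remaining terms have the
    -- same sign.
    have h4 : p'.eval (b' j) = p.eval (b' j) - l ^ 2 / 2 * r.eval (b' j) := by
      rw [eq'] at h3
      rw [ep']
      linear_combination l * h3
    have h5 := sp j hj _ h1.le fun h => (h2 h).trans (H.lt j h).2.1
    have h6 := sr j hj _ h1 fun h => by linarith [h2 h, (H.lt j h).2.1, (H.lt j h).2.2]
    rw [h4]
    have := mul_pos (show 0 < l ^ 2 / 2 by positivity) h6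
    rw [pow_succ (-1 : ℝ)] at this
    linarith
  have Hc : ∀ j, ∃ t, j ≤ n → b' j < t ∧ (j < n → t < c j) ∧ p'.eval t = 0 := by
    intro j
    by_cases hj : j ≤ n
    swap
    · exact ⟨0, fun h => absurd h hj⟩
    have h1 := spb j hj
    rcases eq_or_lt_of_le hj with rfl | hj'
    · obtain ⟨y, hy, hy'⟩ := exists_sign_gt (N := j + 1) (by omega) dp' (by
        rw [cp']
        calc 0 < l ^ 2 / 2 * A := by positivity
          _ = l ^ 2 / 2 * A * ((-1) ^ (j + 1) * (-1) ^ (j + 1)) := by rw [one, mul_one]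
          _ = _ := by ring) (b' j)
      obtain ⟨t, ht, -, h0⟩ := exists_root_between hy h1 hy'
      exact ⟨t, fun _ => ⟨ht, fun h => absurd h (lt_irrefl _), h0⟩⟩
    · have hlt := H.lt j hj'
      have hbj := hb' j hj
      -- At `c j` the term `p` drops out, while `q` and `r` have the same sign there, opposite to
      -- that of `p'` at `b' j`.
      obtain ⟨t, ht, ht', h0⟩ := exists_root_between (f := p') ((hbj.2.1 hj').trans hlt.2.1) h1 (by
        rw [ep', pc j hj', zero_add]
        have e1 := mul_pos (show 0 < l ^ 2 / 2 by positivity)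
          (sr j hj (c j) (by linarith) fun _ => hlt.2.2)
        have e2 := mul_pos hl (sqc j hj')
        linarith)
      exact ⟨t, fun _ => ⟨ht, fun _ => ht', h0⟩⟩
  choose c' hc' using Hc
  -- the roots of `r'`
  have sra : ∀ j ≤ n, 0 < (-1) ^ (j + 1) * r'.eval (a j) := by
    intro j hj
    -- Here `r = 0`, so only `-a j * g * (p + l q)` remains, with `p` and `q` of equal sign and `a j
    -- > 0`.
    rw [er', ep', ra j hj]
    have e1 := sp j hj (a j) le_rfl fun h => by linarith [H.lt j h]
    have e2 := mul_pos hl (sqa j hj)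
    have e3 := mul_pos (mul_pos (hapos j hj) hg) (add_pos e1 e2)
    rw [pow_succ]
    linarith
  have src : ∀ j ≤ n, 0 < (-1) ^ (j + 1) * r'.eval (c' j) := by
    intro j hj
    have h1 := hb' j hj
    have h2 := hc' j hj
    rw [er', h2.2.2, mul_zero, mul_zero, sub_zero]
    exact sr j hj _ (by linarith) fun h => (h2.2.1 h).trans (H.lt j h).2.2
  have p0 : 0 < p'.eval 0 := by
    rw [ep', hr, hq, hp]
    have e1 := rootPoly_eval_zero_pos hD (a := c) (n := n) fun i hi => by
      linarith [H.lt i hi, hapos i hi.le]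
    have e2 := rootPoly_eval_zero_pos hB (a := b) (n := n) fun i hi => by
      linarith [H.lt i hi, hapos i hi.le]
    have e3 := rootPoly_eval_zero_pos hA (a := a) (n := n + 1) fun i hi => hapos i (by omega)
    positivity
  have q0 : 0 < q'.eval 0 := by
    rw [eq', hr, hq]
    have e2 := rootPoly_eval_zero_pos hB (a := b) (n := n) fun i hi => by
      linarith [H.lt i hi, hapos i hi.le]
    have e3 := rootPoly_eval_zero_pos hA (a := a) (n := n + 1) fun i hi => hapos i (by omega)
    positivity
  have r0 : 0 < r'.eval 0 := by
    rw [er', hr, zero_mul, sub_zero]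
    exact rootPoly_eval_zero_pos hA (a := a) (n := n + 1) fun i hi => hapos i (by omega)
  -- The additional smallest root: `r'` is positive at `0` and negative at `a 0`. The other roots of
  -- `r'` follow the `c' j`, where `r' = r`.
  obtain ⟨t0, ht0, ht0', h0⟩ := exists_root_between (f := r') (k := 0) H.pos (by simpa using r0)
    (sra 0 (Nat.zero_le n))
  have Ha : ∀ j, ∃ t, j ≤ n → c' j < t ∧ (j < n → t < a (j + 1)) ∧ r'.eval t = 0 := by
    intro j
    by_cases hj : j ≤ n
    swap
    · exact ⟨0, fun h => absurd h hj⟩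
    have h1 := src j hj
    rcases eq_or_lt_of_le hj with rfl | hj'
    · obtain ⟨y, hy, hy'⟩ := exists_sign_gt (N := j + 1 + 1) (by omega) dr' (by
        rw [cr']
        calc 0 < g * (l ^ 2 / 2) * A := by positivity
          _ = g * (l ^ 2 / 2) * A * ((-1) ^ (j + 1) * (-1) ^ (j + 1)) := by rw [one, mul_one]
          _ = _ := by ring) (c' j)
      obtain ⟨t, ht, -, h0⟩ := exists_root_between hy h1 hy'
      exact ⟨t, fun _ => ⟨ht, fun h => absurd h (lt_irrefl _), h0⟩⟩
    · obtain ⟨t, ht, ht', h0⟩ := exists_root_between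
        (((hc' j hj).2.1 hj').trans (H.lt j hj').2.2) h1 (sra (j + 1) hj')
      exact ⟨t, fun _ => ⟨ht, fun _ => ht', h0⟩⟩
  choose s hs using Ha
  have hlt' : ∀ i < n + 1, (fun j => Nat.casesOn j t0 s : ℕ → ℝ) i < b' i ∧ b' i < c' i ∧
      c' i < (fun j => Nat.casesOn j t0 s : ℕ → ℝ) (i + 1) := by
    intro i hi
    have hi : i ≤ n := by omega
    refine ⟨?_, (hc' i hi).1, (hs i hi).1⟩
    cases i with
    | zero => exact ht0'.trans (hb' 0 hi).1
    | succ i => exact ((hs i (by omega)).2.1 (by omega)).trans (hb' _ hi).1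
  set a' : ℕ → ℝ := fun j => Nat.casesOn j t0 s with ha'
  have hmono : ∀ j ≤ n + 1, ∀ i ≤ j, a' i ≤ a' j := by
    intro j
    induction j with
    | zero => intro _ i hi; rw [Nat.le_zero.1 hi]
    | succ j ih =>
      intro hj i hi
      rcases eq_or_lt_of_le hi with rfl | h
      · exact le_rfl
      · linarith [ih (by omega) i (by omega), hlt' j (by omega)]
  have ha0 : ∀ i ≤ n + 1, 0 < a' i := fun i hi => ht0.trans_le (hmono i hi 0 (Nat.zero_le i))
  -- The roots found, `n + 2` for `r'` and `n + 1` each for `q'` and `p'`, exhaust the degree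
  -- bounds.
  refine ⟨a', b', c', ?_, ?_, ?_, ht0, hlt'⟩
  · refine eq_rootPoly dr' (fun i hi => ha0 i (by omega)) (fun i hi j hj hij => ?_)
      (fun i hi => ?_) r0
    · linarith [hmono j (by omega) (i + 1) hij, hlt' i (by omega)]
    · cases i with
      | zero => exact h0
      | succ i => exact (hs i (by omega)).2.2
  · refine eq_rootPoly dq' (fun i hi => ?_) (fun i hi j hj hij => ?_)
      (fun i hi => (hb' i (by omega)).2.2) q0
    · linarith [ha0 i (by omega), hlt' i hi]
    · linarith [hmono j (by omega) (i + 1) hij, hlt' i (by omega), hlt' j (by omega)]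
  · refine eq_rootPoly dp' (fun i hi => ?_) (fun i hi j hj hij => ?_)
      (fun i hi => (hc' i (by omega)).2.2) p0
    · linarith [ha0 i (by omega), hlt' i hi]
    · linarith [hmono j (by omega) (i + 1) hij, hlt' i (by omega), hlt' j (by omega)]

end CubicString

/-! ### Transfer of the solution from node to node, and the Lagrange identity. -/

namespace CubicString

open Polynomial

/-- The polynomials `φ(ξ k; z)`, `φ_ξ(ξ k; z)`, `φ_ξξ(ξ k + 0; z)` in `z`, for the solution `φ` of
the initial value problem. -/
noncomputable def states (m ξ : ℕ → ℝ) : ℕ → ℝ[X] × ℝ[X] × ℝ[X]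
  | 0 => (C (ξ 0 ^ 2 / 2), C (ξ 0), 1 - X * (C (m 0) * C (ξ 0 ^ 2 / 2)))
  | k + 1 =>
    let s := states m ξ k
    let l := ξ (k + 1) - ξ k
    (s.1 + C l * s.2.1 + C (l ^ 2 / 2) * s.2.2, s.2.1 + C l * s.2.2,
      s.2.2 - X * (C (m (k + 1)) * (s.1 + C l * s.2.1 + C (l ^ 2 / 2) * s.2.2)))

theorem exists_interlacing_states {m ξ : ℕ → ℝ} (hm : ∀ i, 0 < m i) (hξ0 : 0 < ξ 0)
    (hξ : StrictMono ξ) (k : ℕ) :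
    ∃ a b c, Interlacing k (states m ξ k).1 (states m ξ k).2.1 (states m ξ k).2.2 a b c := by
  induction k with
  | zero =>
    have h0 := hm 0
    -- With one mass, `p` and `q` are nonzero constants, so `b` and `c` are irrelevant; `a 0` solves
    -- `1 = z m₀ ξ₀² / 2`.
    refine ⟨fun _ => 2 / (m 0 * ξ 0 ^ 2), fun _ => 0, fun _ => 0,
      ⟨m 0 * ξ 0 ^ 2 / 2, by positivity, ?_⟩, ⟨ξ 0, hξ0, ?_⟩, ⟨ξ 0 ^ 2 / 2, by positivity, ?_⟩,
      by positivity, by simp⟩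
    · have h1 : m 0 * ξ 0 ^ 2 / 2 * (2 / (m 0 * ξ 0 ^ 2)) = 1 := by field_simp
      rw [rootPoly, Finset.prod_range_one, mul_sub, ← C_mul, h1, states, ← C_mul, C_1, mul_comm X,
        mul_div_assoc]
    · simp [rootPoly, states]
    · simp [rootPoly, states]
  | succ k ih =>
    obtain ⟨a, b, c, H⟩ := ih
    exact H.step (sub_pos.2 (hξ (Nat.lt_succ_self k))) (hm (k + 1))

/-- `φ(ξ k; z)` -/
noncomputable def nodeValue (m ξ : ℕ → ℝ) (z : ℂ) (k : ℕ) : ℂ := aeval z (states m ξ k).1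

/-- `φ_ξ(ξ k; z)` -/
noncomputable def nodeSlope (m ξ : ℕ → ℝ) (z : ℂ) (k : ℕ) : ℂ := aeval z (states m ξ k).2.1

/-- `φ_ξξ(ξ k + 0; z)` -/
noncomputable def nodeCurv (m ξ : ℕ → ℝ) (z : ℂ) (k : ℕ) : ℂ := aeval z (states m ξ k).2.2

section Nodes

variable (m ξ : ℕ → ℝ) (z w : ℂ) (k : ℕ)

theorem nodeValue_zero : nodeValue m ξ z 0 = ξ 0 ^ 2 / 2 := by
  simp [nodeValue, states]

theorem nodeSlope_zero : nodeSlope m ξ z 0 = ξ 0 := by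
  simp [nodeSlope, states]

theorem nodeCurv_zero : nodeCurv m ξ z 0 = 1 - z * (m 0 * nodeValue m ξ z 0) := by
  simp [nodeValue, nodeCurv, states]

theorem nodeValue_succ : nodeValue m ξ z (k + 1) = nodeValue m ξ z k +
    (ξ (k + 1) - ξ k) * nodeSlope m ξ z k + (ξ (k + 1) - ξ k) ^ 2 / 2 * nodeCurv m ξ z k := by
  simp [nodeValue, nodeSlope, nodeCurv, states]

theorem nodeSlope_succ : nodeSlope m ξ z (k + 1) =
    nodeSlope m ξ z k + (ξ (k + 1) - ξ k) * nodeCurv m ξ z k := by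
  simp [nodeSlope, nodeCurv, states]

theorem nodeCurv_succ : nodeCurv m ξ z (k + 1) =
    nodeCurv m ξ z k - z * (m (k + 1) * nodeValue m ξ z (k + 1)) := by
  simp [nodeValue, nodeCurv, states]

theorem nodeCurv_eq : nodeCurv m ξ z k =
    1 - ∑ i ∈ Finset.range (k + 1), z * (m i * nodeValue m ξ z i) := by
  induction k with
  | zero => rw [Finset.sum_range_one, nodeCurv_zero]
  | succ k ih => rw [Finset.sum_range_succ, nodeCurv_succ, ih]; ring

/-- The left side extrapolates the state at `ξ k` to `x`. Moving the base point to the next node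
changes it only by the jump of curvature there, so the induction works with `x` kept free. The same
applies to `nodeValue_eq`; both connect the recursion with the spline formula. -/
theorem nodeSlope_eq (x : ℂ) : nodeSlope m ξ z k + (x - ξ k) * nodeCurv m ξ z k =
    x - ∑ i ∈ Finset.range (k + 1), z * (m i * nodeValue m ξ z i) * (x - ξ i) := by
  induction k with
  | zero => rw [Finset.sum_range_one, nodeCurv_zero, nodeSlope_zero]; ring
  | succ k ih =>
    rw [Finset.sum_range_succ, nodeCurv_succ, nodeSlope_succ]
    linear_combination ih

theorem nodeValue_eq (x : ℂ) : nodeValue m ξ z k + (x - ξ k) * nodeSlope m ξ z k +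
      (x - ξ k) ^ 2 / 2 * nodeCurv m ξ z k =
    x ^ 2 / 2 - ∑ i ∈ Finset.range (k + 1),
      z * (m i * nodeValue m ξ z i) * ((x - ξ i) ^ 2 / 2) := by
  induction k with
  | zero => rw [Finset.sum_range_one, nodeCurv_zero, nodeSlope_zero, nodeValue_zero]; ring
  | succ k ih =>
    rw [Finset.sum_range_succ, nodeCurv_succ, nodeSlope_succ]
    rw [show nodeValue m ξ z (k + 1) = _ from nodeValue_succ m ξ z k]
    linear_combination ih

/-- The Lagrange identity. -/
theorem sum_nodeValue_mul_nodeValue :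
    (z + w) * ∑ i ∈ Finset.range (k + 1), m i * (nodeValue m ξ z i * nodeValue m ξ w i) =
      nodeSlope m ξ z k * nodeSlope m ξ w k - nodeValue m ξ z k * nodeCurv m ξ w k -
        nodeValue m ξ w k * nodeCurv m ξ z k := by
  induction k with
  | zero =>
    rw [Finset.sum_range_one, nodeCurv_zero, nodeCurv_zero, nodeSlope_zero, nodeSlope_zero,
      nodeValue_zero, nodeValue_zero]
    ring
  | succ k ih =>
    -- The right side is constant along a massless interval, and a mass adds `(z + w) m` times the
    -- product of the two values.
    rw [Finset.sum_range_succ, nodeCurv_succ, nodeCurv_succ, nodeSlope_succ, nodeSlope_succ,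
      mul_add, ih]
    rw [nodeValue_succ m ξ z k, nodeValue_succ m ξ w k]
    ring

end Nodes

theorem aeval_rootPoly (A : ℝ) (a : ℕ → ℝ) (n : ℕ) (z : ℂ) :
    aeval z (rootPoly A a n) = A * ∏ i ∈ Finset.range n, ((a i : ℂ) - z) := by
  simp [rootPoly, map_prod]

theorem aeval_rootPoly_eq_zero_iff {A : ℝ} (hA : 0 < A) (a : ℕ → ℝ) (n : ℕ) (z : ℂ) :
    aeval z (rootPoly A a n) = 0 ↔ ∃ i < n, z = a i := by
  rw [aeval_rootPoly, mul_eq_zero, Finset.prod_eq_zero_iff]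
  simp [hA.ne', sub_eq_zero, eq_comm]

/-- Splitting off the factor of `a i` leaves a cofactor that does not vanish there, the other roots
being different. The sign comes from `a i - z = -(z - a i)`. -/
theorem analyticOrderAt_rootPoly {A : ℝ} (hA : 0 < A) {a : ℕ → ℝ} {n i : ℕ} (hi : i < n)
    (hne : ∀ j < n, j ≠ i → a j ≠ a i) :
    analyticOrderAt (fun z : ℂ => aeval z (rootPoly A a n)) (a i) = 1 := by
  have hf : AnalyticAt ℂ (fun z : ℂ => aeval z (rootPoly A a n)) (a i) := by
    simp only [aeval_rootPoly]
    fun_prop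
  rw [show (1 : ℕ∞) = (1 : ℕ) from rfl, hf.analyticOrderAt_eq_natCast]
  refine ⟨fun z => - (A * ∏ j ∈ (Finset.range n).erase i, ((a j : ℂ) - z)), by fun_prop, ?_, ?_⟩
  · refine neg_ne_zero.2 (mul_ne_zero (by exact_mod_cast hA.ne') (Finset.prod_ne_zero_iff.2 ?_))
    intro j hj
    rw [Finset.mem_erase, Finset.mem_range] at hj
    exact sub_ne_zero.2 (by exact_mod_cast hne j hj.2 hj.1)
  · refine Filter.Eventually.of_forall fun z => ?_
    dsimp only
    rw [aeval_rootPoly, ← Finset.mul_prod_erase _ _ (Finset.mem_range.2 hi), smul_eq_mul, pow_one]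
    ring

end CubicString

/-! ### Test functions and distributional derivatives on `(0, ∞)`. -/

namespace CubicString

open MeasureTheory

/-- The smooth functions with compact support in `(0, ∞)`. -/
structure IsTest (η : ℝ → ℝ) : Prop where
  smooth : ContDiff ℝ ∞ η
  compact : HasCompactSupport η
  supp : tsupport η ⊆ Set.Ioi 0

theorem IsTest.exists_Icc {η : ℝ → ℝ} (h : IsTest η) :
    ∃ a b, 0 < a ∧ a ≤ b ∧ ∀ x, x ∉ Set.Icc a b → η x = 0 := by
  rcases (tsupport η).eq_empty_or_nonempty with he | hne
  · exact ⟨1, 1, one_pos, le_rfl, fun x _ => image_eq_zero_of_notMem_tsupport (by simp [he])⟩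
  obtain ⟨a, ha, ha'⟩ := h.compact.isCompact.exists_isLeast hne
  obtain ⟨b, hb, hb'⟩ := h.compact.isCompact.exists_isGreatest hne
  exact ⟨a, b, h.supp ha, ha' hb, fun x hx =>
    image_eq_zero_of_notMem_tsupport fun hx' => hx ⟨ha' hx', hb' hx'⟩⟩

theorem isTest_of_Icc {η : ℝ → ℝ} (hη : ContDiff ℝ ∞ η) {a b : ℝ} (ha : 0 < a)
    (h : ∀ x, x ∉ Set.Icc a b → η x = 0) : IsTest η := by
  have hs : tsupport η ⊆ Set.Icc a b :=
    closure_minimal (fun x hx => by_contra fun hx' => hx (h x hx')) isClosed_Icc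
  exact ⟨hη, HasCompactSupport.of_support_subset_isCompact isCompact_Icc
    ((subset_tsupport _).trans hs), fun x hx => ha.trans_le (hs hx).1⟩

theorem IsTest.contDiff {η : ℝ → ℝ} (h : IsTest η) (k : ℕ) : ContDiff ℝ k η :=
  h.smooth.of_le (by exact_mod_cast le_top)

theorem IsTest.integrable {η : ℝ → ℝ} (h : IsTest η) : Integrable η :=
  h.smooth.continuous.integrable_of_hasCompactSupport h.compact

theorem IsTest.eq_zero {η : ℝ → ℝ} (h : IsTest η) {x : ℝ} (hx : x ≤ 0) : η x = 0 :=
  image_eq_zero_of_notMem_tsupport fun hx' => absurd (h.supp hx') (not_lt.2 hx)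

theorem IsTest.isTest_deriv {η : ℝ → ℝ} (h : IsTest η) : IsTest (deriv η) :=
  ⟨(contDiff_infty_iff_deriv.1 h.smooth).2, h.compact.deriv,
    tsupport_deriv_subset.trans h.supp⟩

theorem IsTest.isTest_iteratedDeriv {η : ℝ → ℝ} (h : IsTest η) (k : ℕ) :
    IsTest (iteratedDeriv k η) := by
  induction k with
  | zero => rwa [iteratedDeriv_zero]
  | succ k ih => rw [iteratedDeriv_succ]; exact ih.isTest_deriv

theorem IsTest.sub_smul {η θ : ℝ → ℝ} (h : IsTest η) (h' : IsTest θ) (c : ℝ) :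
    IsTest (η - c • θ) := by
  obtain ⟨a, b, ha, hab, h1⟩ := h.exists_Icc
  obtain ⟨a', b', ha', hab', h1'⟩ := h'.exists_Icc
  refine isTest_of_Icc (h.smooth.sub (h'.smooth.const_smul c)) (lt_min ha ha') (b := max b b') ?_
  intro x hx
  have e1 := h1 x fun hx' => hx ⟨(min_le_left _ _).trans hx'.1, hx'.2.trans (le_max_left _ _)⟩
  have e2 := h1' x fun hx' => hx ⟨(min_le_right _ _).trans hx'.1, hx'.2.trans (le_max_right _ _)⟩
  simp [e1, e2]

/-- The primitive started at the left end of the support is constant beyond the right end, with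
value the total integral, which is zero. -/
theorem IsTest.exists_deriv_eq {η : ℝ → ℝ} (h : IsTest η) (h0 : ∫ x, η x = 0) :
    ∃ θ, IsTest θ ∧ deriv θ = η := by
  obtain ⟨a, b, ha, hab, hz⟩ := h.exists_Icc
  have hd : ∀ x, HasDerivAt (fun y => ∫ t in a..y, η t) (η x) x := fun x =>
    intervalIntegral.integral_hasDerivAt_right (h.smooth.continuous.intervalIntegrable _ _)
      (h.smooth.continuous.stronglyMeasurableAtFilter _ _)
      h.smooth.continuous.continuousAt
  have hde : deriv (fun y => ∫ t in a..y, η t) = η := funext fun x => (hd x).deriv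
  refine ⟨_, isTest_of_Icc (a := a) (b := b) ?_ ha ?_, hde⟩
  · rw [contDiff_infty_iff_deriv, hde]
    exact ⟨fun x => (hd x).differentiableAt, h.smooth⟩
  · intro x hx
    rcases lt_or_ge x a with hxa | hxa
    · refine intervalIntegral.integral_zero_ae ?_
      filter_upwards [compl_mem_ae_iff.2 (measure_singleton a)] with t hta ht
      rw [Set.uIoc_of_ge hxa.le] at ht
      exact hz t fun h' => hta (le_antisymm ht.2 h'.1)
    · have hxb : b < x := lt_of_not_ge fun h' => hx ⟨hxa, h'⟩
      rw [← h0, intervalIntegral.integral_of_le hxa]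
      refine setIntegral_eq_integral_of_ae_compl_eq_zero ?_
      filter_upwards [compl_mem_ae_iff.2 (measure_singleton a)] with t hta ht
      refine hz t fun h' => ht ⟨lt_of_le_of_ne h'.1 fun e => hta e.symm, h'.2.trans hxb.le⟩

theorem exists_isTest_integral_eq_one : ∃ η, IsTest η ∧ ∫ x, η x = 1 := by
  let f : ContDiffBump (2 : ℝ) := ⟨1 / 2, 1, by norm_num, by norm_num⟩
  refine ⟨f.normed volume, ⟨f.contDiff_normed, f.hasCompactSupport_normed, ?_⟩,
    f.integral_normed⟩
  rw [f.tsupport_normed_eq, Real.closedBall_eq_Icc]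
  intro x hx
  have := hx.1
  simp only [f] at this
  exact lt_of_lt_of_le (by norm_num) this

theorem IsTest.integrable_mul {η : ℝ → ℝ} (h : IsTest η) {ψ : ℝ → ℂ} (hψ : Continuous ψ) :
    Integrable fun x => (η x : ℂ) * ψ x := by
  refine Continuous.integrable_of_hasCompactSupport ?_ ?_
  · exact (Complex.continuous_ofReal.comp h.smooth.continuous).mul hψ
  · exact (h.compact.comp_left (g := ((↑) : ℝ → ℂ)) Complex.ofReal_zero).mul_right

/-- Moments of derivatives of test functions. -/
theorem IsTest.integral_iteratedDeriv_mul_pow {η : ℝ → ℝ} (h : IsTest η) (k : ℕ) :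
    ∫ x, iteratedDeriv k η x * x ^ k = (-1) ^ k * (k.factorial : ℝ) * ∫ x, η x := by
  induction k with
  | zero => simp
  | succ k ih =>
    have hk := h.isTest_iteratedDeriv k
    have hint : ∀ {θ : ℝ → ℝ} (_ : IsTest θ) {u : ℝ → ℝ} (_ : Continuous u),
        Integrable (u * θ) := fun hθ _ hu =>
      (Continuous.mul hu hθ.smooth.continuous).integrable_of_hasCompactSupport hθ.compact.mul_left
    have key := integral_mul_deriv_eq_deriv_mul_of_integrable
      (u := fun x : ℝ => x ^ (k + 1)) (v := iteratedDeriv k η)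
      (u' := fun x : ℝ => ((k + 1 : ℕ) : ℝ) * x ^ k) (v' := deriv (iteratedDeriv k η))
      (fun x _ => by simpa using hasDerivAt_pow (k + 1) x)
      (fun x _ => (hk.smooth.differentiable (by simp) x).hasDerivAt)
      (hint hk.isTest_deriv (u := fun x => x ^ (k + 1)) (by fun_prop))
      (hint hk (u := fun x => ((k + 1 : ℕ) : ℝ) * x ^ k) (by fun_prop))
      (hint hk (u := fun x => x ^ (k + 1)) (by fun_prop))
    rw [iteratedDeriv_succ]
    calc ∫ x, deriv (iteratedDeriv k η) x * x ^ (k + 1)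
        = ∫ x, x ^ (k + 1) * deriv (iteratedDeriv k η) x := by simp only [mul_comm]
      _ = -∫ x, ((k + 1 : ℕ) : ℝ) * (iteratedDeriv k η x * x ^ k) := by
        rw [key]; congr 2; ext x; ring
      _ = _ := by
        rw [integral_const_mul, ih, Nat.factorial_succ]; push_cast; ring

/-- A function whose `k`-th distributional derivative vanishes is a polynomial of degree
less than `k`. -/
theorem exists_eq_sum_pow_of_integral_iteratedDeriv_mul_eq_zero (k : ℕ) {ψ : ℝ → ℂ}
    (hψ : Continuous ψ)
    (h : ∀ η, IsTest η → ∫ x, ((iteratedDeriv k η x : ℝ) : ℂ) * ψ x = 0) :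
    ∃ c : ℕ → ℂ, ∀ x, 0 < x → ψ x = ∑ i ∈ Finset.range k, c i * (x : ℂ) ^ i := by
  induction k generalizing ψ with
  | zero =>
    refine ⟨0, fun x hx => ?_⟩
    -- The fundamental lemma of the calculus of variations gives vanishing almost everywhere, and
    -- continuity upgrades this to every point.
    have hae := isOpen_Ioi.ae_eq_zero_of_integral_contDiff_smul_eq_zero (U := Set.Ioi (0 : ℝ))
      (f := ψ) (μ := volume) (hψ.locallyIntegrable.locallyIntegrableOn _) (fun η h1 h2 h3 => by
        simpa using h η ⟨h1, h2, h3⟩)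
    have hEq := MeasureTheory.Measure.eqOn_open_of_ae_eq (μ := volume) (U := Set.Ioi (0 : ℝ))
      (f := ψ) (g := 0) ((ae_restrict_iff' measurableSet_Ioi).2 hae) isOpen_Ioi hψ.continuousOn
      continuousOn_const
    simpa using hEq hx
  | succ k ih =>
    obtain ⟨η₀, hη₀, h1⟩ := exists_isTest_integral_eq_one
    set I : ℂ := ∫ x, ((iteratedDeriv k η₀ x : ℝ) : ℂ) * ψ x with hI
    -- Since `η - (∫ η) η₀` is the derivative of a test function, the hypothesis forces `∫ η⁽ᵏ⁾ ψ =
    -- I ∫ η`. The monomial `d xᵏ` pairs to `d (-1)ᵏ k! ∫ η`, so this `d`, equal to `I (-1)ᵏ / k!`,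
    -- makes `ψ - d xᵏ` satisfy the hypothesis of order `k`.
    set d : ℂ := I * ((-1) ^ k * (k.factorial : ℂ)) / ((k.factorial : ℂ) ^ 2) with hd
    have hψ' : Continuous fun x : ℝ => ψ x - d * (x : ℂ) ^ k := by fun_prop
    obtain ⟨c, hc⟩ := ih hψ' (fun η hη => by
      obtain ⟨θ, hθ, hθ'⟩ := (hη.sub_smul hη₀ (∫ x, η x)).exists_deriv_eq (by
        simp only [Pi.sub_apply, Pi.smul_apply, smul_eq_mul]
        rw [integral_sub hη.integrable (hη₀.integrable.const_mul _), integral_const_mul, h1,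
          mul_one, sub_self])
      have e1 := h θ hθ
      have e2 : ∀ x, iteratedDeriv (k + 1) θ x =
          iteratedDeriv k η x - (∫ x, η x) * iteratedDeriv k η₀ x := fun x => by
        rw [iteratedDeriv_succ', hθ', iteratedDeriv_sub
          (hη.contDiff k).contDiffAt
          (show ContDiffAt ℝ k ((∫ x, η x) • η₀) x from
            ((hη₀.contDiff k).const_smul (∫ x, η x)).contDiffAt),
          iteratedDeriv_const_smul_field, smul_eq_mul]
      have i1 := (hη.isTest_iteratedDeriv k).integrable_mul hψ
      have i2 := (hη₀.isTest_iteratedDeriv k).integrable_mul hψ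
      have i3 := (hη.isTest_iteratedDeriv k).integrable_mul
        (show Continuous fun x : ℝ => (x : ℂ) ^ k by fun_prop)
      have e3 : ∫ x, ((iteratedDeriv k η x : ℝ) : ℂ) * ψ x = (∫ x, η x : ℝ) * I := by
        rw [← sub_eq_zero, hI, ← integral_const_mul, ← integral_sub i1 (i2.const_mul _), ← e1]
        congr 1
        ext x
        rw [e2]
        push_cast
        ring
      have e4 : ∫ x, ((iteratedDeriv k η x : ℝ) : ℂ) * (x : ℂ) ^ k =
          (-1) ^ k * (k.factorial : ℂ) * (∫ x, η x : ℝ) := by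
        have := congrArg ((↑) : ℝ → ℂ) (hη.integral_iteratedDeriv_mul_pow k)
        rw [← integral_complex_ofReal] at this
        push_cast at this ⊢
        exact this
      calc ∫ x, ((iteratedDeriv k η x : ℝ) : ℂ) * (ψ x - d * (x : ℂ) ^ k)
          = ∫ x, (((iteratedDeriv k η x : ℝ) : ℂ) * ψ x -
              d * (((iteratedDeriv k η x : ℝ) : ℂ) * (x : ℂ) ^ k)) := by
            congr 1; ext x; ring
        _ = 0 := by
          rw [integral_sub i1 (i3.const_mul _), integral_const_mul, e3, e4, hd]
          have hf : (k.factorial : ℂ) ≠ 0 := by exact_mod_cast k.factorial_ne_zero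
          have hs : ((-1 : ℂ) ^ k) * (-1) ^ k = 1 := by rw [← mul_pow]; simp
          field_simp
          linear_combination (-((∫ x, η x : ℝ) : ℂ)) * I * hs)
    refine ⟨fun i => if i = k then d else c i, fun x hx => ?_⟩
    have e : ∀ i ∈ Finset.range k, (if i = k then d else c i) * (x : ℂ) ^ i = c i * (x : ℂ) ^ i :=
      fun i hi => by rw [if_neg (Finset.mem_range.1 hi).ne]
    rw [Finset.sum_range_succ, Finset.sum_congr rfl e, ← hc x hx]
    simp

/-- `(x - a)₊² / 2` -/
noncomputable def ramp (a x : ℝ) : ℝ := max (x - a) 0 ^ 2 / 2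

theorem continuous_ramp (a : ℝ) : Continuous (ramp a) := by
  unfold ramp; fun_prop

theorem ramp_of_le {a x : ℝ} (h : x ≤ a) : ramp a x = 0 := by
  rw [ramp, max_eq_right (by linarith)]; simp

theorem ramp_of_ge {a x : ℝ} (h : a ≤ x) : ramp a x = (x - a) ^ 2 / 2 := by
  rw [ramp, max_eq_left (by linarith)]

/-- `ramp a` is a fundamental solution of the third derivative; the sign comes from three
integrations by parts. -/
theorem IsTest.integral_iteratedDeriv_mul_ramp {η : ℝ → ℝ} (h : IsTest η) (a : ℝ) :
    ∫ x, iteratedDeriv 3 η x * ramp a x = - η a := by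
  have h1 := h.isTest_deriv
  have h2 := h1.isTest_deriv
  -- A compactly supported primitive of `η''' (x - a)² / 2` with `F a = η a`, so its derivative
  -- integrates over `(a, ∞)` to `-η a`.
  let F : ℝ → ℝ := fun x =>
    deriv (deriv η) x * ((x - a) ^ 2 / 2) - deriv η x * (x - a) + η x
  have hd : ∀ {θ : ℝ → ℝ} (_ : IsTest θ) (x), HasDerivAt θ (deriv θ x) x := fun hθ x =>
    (hθ.smooth.differentiable (by simp) x).hasDerivAt
  have hF : ∀ x, deriv F x = iteratedDeriv 3 η x * ((x - a) ^ 2 / 2) := fun x => by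
    have e1 : HasDerivAt (fun y : ℝ => y - a) 1 x := (hasDerivAt_id x).sub_const a
    have := (((hd h2 x).mul ((e1.pow 2).div_const 2)).sub ((hd h1 x).mul e1)).add (hd h x)
    have e2 : iteratedDeriv 3 η x = deriv (deriv (deriv η)) x := by
      rw [iteratedDeriv_succ, iteratedDeriv_succ, iteratedDeriv_one]
    rw [e2]
    refine (HasDerivAt.deriv (f := F) this).trans ?_
    simp only [Pi.pow_apply]
    push_cast
    ring
  have hFs : ContDiff ℝ 1 F := by
    have a0 : ContDiff ℝ 1 η := h.contDiff 1
    have a1 : ContDiff ℝ 1 (deriv η) := h1.contDiff 1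
    have a2 : ContDiff ℝ 1 (deriv (deriv η)) :=
      h2.contDiff 1
    fun_prop
  have hFc : HasCompactSupport F :=
    ((h2.compact.mul_right).sub (h1.compact.mul_right)).add h.compact
  have key := hFc.integral_Ioi_deriv_eq hFs a
  rw [← integral_indicator measurableSet_Ioi] at key
  calc _ = ∫ x, Set.indicator (Set.Ioi a) (deriv F) x := by
        congr 1
        ext x
        by_cases hx : a < x
        · rw [Set.indicator_of_mem (Set.mem_Ioi.2 hx), hF, ramp_of_ge hx.le]
        · rw [Set.indicator_of_notMem (by simpa using hx), ramp_of_le (not_lt.1 hx), mul_zero]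
    _ = _ := by rw [key]; simp [F]

end CubicString

/-! ### Quadratic splines and their equivalence with weak solutions. -/

namespace CubicString

open MeasureTheory

/-- `A + B x + C x² / 2 - ∑ d i (x - ξ i)₊² / 2`, over `i < n`. -/
noncomputable def spline (A B C : ℂ) (d : ℕ → ℂ) (ξ : ℕ → ℝ) (n : ℕ) (x : ℝ) : ℂ :=
  A + B * x + C * ((x : ℂ) ^ 2 / 2) - ∑ i ∈ Finset.range n, d i * (ramp (ξ i) x : ℂ)

/-- The first derivative of `spline`. -/
noncomputable def splineDeriv (B C : ℂ) (d : ℕ → ℂ) (ξ : ℕ → ℝ) (n : ℕ) (x : ℝ) : ℂ :=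
  B + C * x - ∑ i ∈ Finset.range n, d i * ((max (x - ξ i) 0 : ℝ) : ℂ)

/-- The second right derivative of `spline`. -/
noncomputable def splineDeriv2 (C : ℂ) (d : ℕ → ℂ) (ξ : ℕ → ℝ) (n : ℕ) (x : ℝ) : ℂ :=
  C - ∑ i ∈ Finset.range n, d i * (((if ξ i ≤ x then 1 else 0 : ℝ)) : ℂ)

theorem hasDerivWithinAt_ramp (a x : ℝ) :
    HasDerivWithinAt (ramp a) (max (x - a) 0) (Set.Ioi x) x := by
  rcases le_or_gt a x with h | h
  · rw [max_eq_left (by linarith)]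
    have e1 : HasDerivAt (fun y : ℝ => (y - a) ^ 2 / 2) (x - a) x :=
      ((((hasDerivAt_id x).sub_const a).pow 2).div_const 2).congr_deriv (by simp)
    exact e1.hasDerivWithinAt.congr (fun y hy => ramp_of_ge (h.trans (le_of_lt hy)))
      (ramp_of_ge h)
  · rw [max_eq_right (by linarith)]
    refine ((hasDerivAt_const x (0 : ℝ)).congr_of_eventuallyEq ?_).hasDerivWithinAt
    filter_upwards [Iio_mem_nhds h] with y hy
    exact ramp_of_le (le_of_lt hy)

/-- The slope is already `1` at `x = a`. Hence a mass sitting at a point is counted in the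
right-hand second derivative there, in particular the mass at `1`. -/
theorem hasDerivWithinAt_max_sub (a x : ℝ) :
    HasDerivWithinAt (fun y => max (y - a) 0) (if a ≤ x then 1 else 0) (Set.Ioi x) x := by
  split_ifs with h
  · refine (((hasDerivAt_id x).sub_const a).hasDerivWithinAt).congr (fun y hy => ?_) ?_
    · exact max_eq_left (sub_nonneg.2 (h.trans (le_of_lt hy)))
    · exact max_eq_left (sub_nonneg.2 h)
  · rw [not_le] at h
    refine ((hasDerivAt_const x (0 : ℝ)).congr_of_eventuallyEq ?_).hasDerivWithinAt
    filter_upwards [Iio_mem_nhds h] with y hy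
    exact max_eq_right (sub_nonpos.2 (le_of_lt hy))

section Spline

variable {A B C : ℂ} {d : ℕ → ℂ} {ξ : ℕ → ℝ} {n : ℕ} {φ : ℝ → ℂ}

theorem continuous_spline : Continuous (spline A B C d ξ n) := by
  unfold spline
  have := fun i => Complex.continuous_ofReal.comp (continuous_ramp (ξ i))
  fun_prop

theorem hasDerivWithinAt_spline (x : ℝ) :
    HasDerivWithinAt (spline A B C d ξ n) (splineDeriv B C d ξ n x) (Set.Ioi x) x := by
  have e0 : HasDerivAt (fun y : ℝ => (y : ℂ)) 1 x := Complex.ofRealCLM.hasDerivAt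
  have e1 : HasDerivAt (fun y : ℝ => A + B * y + C * ((y : ℂ) ^ 2 / 2)) (B + C * x) x :=
    (((e0.const_mul B).const_add A).add (((e0.pow 2).div_const 2).const_mul C)).congr_deriv
      (by simp)
  exact e1.hasDerivWithinAt.sub (HasDerivWithinAt.fun_sum fun i _ =>
    ((hasDerivWithinAt_ramp (ξ i) x).ofReal_comp).const_mul (d i))

theorem hasDerivWithinAt_splineDeriv (x : ℝ) :
    HasDerivWithinAt (splineDeriv B C d ξ n) (splineDeriv2 C d ξ n x) (Set.Ioi x) x := by
  have e0 : HasDerivAt (fun y : ℝ => (y : ℂ)) 1 x := Complex.ofRealCLM.hasDerivAt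
  have e1 : HasDerivAt (fun y : ℝ => B + C * (y : ℂ)) C x :=
    ((e0.const_mul C).const_add B).congr_deriv (by simp)
  exact e1.hasDerivWithinAt.sub (HasDerivWithinAt.fun_sum fun i _ =>
    ((hasDerivWithinAt_max_sub (ξ i) x).ofReal_comp).const_mul (d i))

theorem rightDeriv_eqOn {F F' : ℝ → ℂ} (h : Set.EqOn φ F (Set.Ici 0))
    (hF : ∀ x, HasDerivWithinAt F (F' x) (Set.Ioi x) x) :
    Set.EqOn (rightDeriv φ) F' (Set.Ici 0) := fun x hx =>
  ((hF x).congr (fun _ hy => h (Set.mem_Ici.2 (le_trans hx (le_of_lt hy)))) (h hx)).derivWithin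
    (uniqueDiffWithinAt_Ioi x)

theorem rightDeriv_eqOn_splineDeriv (h : Set.EqOn φ (spline A B C d ξ n) (Set.Ici 0)) :
    Set.EqOn (rightDeriv φ) (splineDeriv B C d ξ n) (Set.Ici 0) :=
  rightDeriv_eqOn h hasDerivWithinAt_spline

theorem rightDeriv_rightDeriv_eqOn_splineDeriv2
    (h : Set.EqOn φ (spline A B C d ξ n) (Set.Ici 0)) :
    Set.EqOn (rightDeriv (rightDeriv φ)) (splineDeriv2 C d ξ n) (Set.Ici 0) :=
  rightDeriv_eqOn (rightDeriv_eqOn_splineDeriv h) hasDerivWithinAt_splineDeriv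

variable (hξ0 : ∀ i, 0 < ξ i)

include hξ0

theorem spline_zero : spline A B C d ξ n 0 = A := by
  simp [spline, ramp_of_le (hξ0 _).le]

theorem splineDeriv_zero : splineDeriv B C d ξ n 0 = B := by
  simp [splineDeriv, max_eq_right (neg_nonpos.2 (hξ0 _).le)]

theorem splineDeriv2_zero : splineDeriv2 C d ξ n 0 = C := by
  simp [splineDeriv2, not_le.2 (hξ0 _)]

end Spline

/-- The mass distribution with the first `n` point masses of two sequences. -/
noncomputable def truncMeasure (m ξ : ℕ → ℝ) (n : ℕ) : Measure ℝ :=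
  massMeasure (fun i : Fin n => m i) (fun i : Fin n => ξ i)

theorem integrable_massMeasure {E : Type*} [NormedAddCommGroup E] {n : ℕ} (m ξ : Fin n → ℝ)
    (F : ℝ → E) :
    Integrable F (massMeasure m ξ) :=
  integrable_finsetSum_measure.2 fun i _ =>
    (integrable_dirac (by simp)).smul_measure ENNReal.ofReal_ne_top

theorem integral_truncMeasure {m : ℕ → ℝ} (hm : ∀ i, 0 < m i) (ξ : ℕ → ℝ) (n : ℕ) (F : ℝ → ℂ) :
    ∫ x, F x ∂(truncMeasure m ξ n) = ∑ i ∈ Finset.range n, (m i : ℂ) * F (ξ i) := by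
  rw [truncMeasure, massMeasure, integral_finsetSum_measure fun i _ =>
    (integrable_dirac (by simp)).smul_measure ENNReal.ofReal_ne_top, Finset.sum_range]
  refine Finset.sum_congr rfl fun i _ => ?_
  rw [integral_smul_measure, integral_dirac, ENNReal.toReal_ofReal (hm i).le]
  simp

section Solution

variable {m ξ : ℕ → ℝ} {n : ℕ} {z C : ℂ} {φ : ℝ → ℂ} (hm : ∀ i, 0 < m i) (hξ0 : ∀ i, 0 < ξ i)
  (hξ : StrictMono ξ)

theorem IsTest.integral_mul_ramp {η : ℝ → ℝ} (h : IsTest η) (a : ℝ) :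
    ∫ x, ((iteratedDeriv 3 η x : ℝ) : ℂ) * (ramp a x : ℂ) = - (η a : ℂ) := by
  have := congrArg ((↑) : ℝ → ℂ) (h.integral_iteratedDeriv_mul_ramp a)
  rw [← integral_complex_ofReal] at this
  push_cast at this
  exact this

theorem IsTest.integral_mul_sum_ramp {η : ℝ → ℝ} (h : IsTest η) (d : ℕ → ℂ) (ξ : ℕ → ℝ) (n : ℕ) :
    ∫ x, ((iteratedDeriv 3 η x : ℝ) : ℂ) * ∑ i ∈ Finset.range n, d i * (ramp (ξ i) x : ℂ) =
      - ∑ i ∈ Finset.range n, d i * (η (ξ i) : ℂ) := by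
  have hint : ∀ i, Integrable fun x => ((iteratedDeriv 3 η x : ℝ) : ℂ) * (ramp (ξ i) x : ℂ) :=
    fun i => (h.isTest_iteratedDeriv 3).integrable_mul
    (Complex.continuous_ofReal.comp (continuous_ramp (ξ i)))
  calc _ = ∫ x, ∑ i ∈ Finset.range n,
        d i * (((iteratedDeriv 3 η x : ℝ) : ℂ) * (ramp (ξ i) x : ℂ)) := by
        congr 1; ext x; rw [Finset.mul_sum]; exact Finset.sum_congr rfl fun i _ => by ring
    _ = _ := by
      rw [integral_finsetSum _ fun i _ => (hint i).const_mul (d i), ← Finset.sum_neg_distrib]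
      refine Finset.sum_congr rfl fun i _ => ?_
      rw [integral_const_mul, h.integral_mul_ramp]
      ring

include hm

theorem isSolution_of_eqOn_spline (h : Set.EqOn φ
    (spline 0 0 C (fun i => z * (m i * φ (ξ i))) ξ n) (Set.Ici 0)) :
    IsSolution (truncMeasure m ξ n) z φ := by
  refine ⟨continuous_spline.continuousOn.congr h, fun η h1 h2 h3 => ?_⟩
  have hη : IsTest η := ⟨h1, h2, h3⟩
  -- On `(0, ∞)` the function `x² / 2` is `ramp 0`, whose pairing is `-η 0 = 0`.
  have h0 := hη.integral_mul_ramp 0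
  rw [hη.eq_zero le_rfl, Complex.ofReal_zero, neg_zero] at h0
  have i1 : Integrable fun x => ((iteratedDeriv 3 η x : ℝ) : ℂ) * (ramp 0 x : ℂ) :=
    (hη.isTest_iteratedDeriv 3).integrable_mul (Complex.continuous_ofReal.comp (continuous_ramp 0))
  have i2 := (hη.isTest_iteratedDeriv 3).integrable_mul (ψ := fun x =>
    ∑ i ∈ Finset.range n, z * (m i * φ (ξ i)) * (ramp (ξ i) x : ℂ)) (by
      have := fun i => Complex.continuous_ofReal.comp (continuous_ramp (ξ i))
      fun_prop)
  calc _ = ∫ x, (C * (((iteratedDeriv 3 η x : ℝ) : ℂ) * (ramp 0 x : ℂ)) -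
        ((iteratedDeriv 3 η x : ℝ) : ℂ) *
          ∑ i ∈ Finset.range n, z * (m i * φ (ξ i)) * (ramp (ξ i) x : ℂ)) := by
        congr 1
        ext x
        rcases le_or_gt x 0 with hx | hx
        · simp [(hη.isTest_iteratedDeriv 3).eq_zero hx]
        · rw [h (Set.mem_Ici.2 hx.le), spline, ramp_of_ge hx.le]
          push_cast
          ring
    _ = _ := by
      rw [integral_sub (i1.const_mul C) i2, integral_const_mul, h0, hη.integral_mul_sum_ramp,
        integral_truncMeasure hm, mul_zero, zero_sub, neg_neg, Finset.mul_sum]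
      exact Finset.sum_congr rfl fun i _ => by ring

/-- Adding the ramps cancels the point masses, leaving a continuous function with vanishing third
derivative, that is, a quadratic polynomial. -/
theorem IsSolution.exists_eqOn_spline (h : IsSolution (truncMeasure m ξ n) z φ) :
    ∃ A B C, Set.EqOn φ (spline A B C (fun i => z * (m i * φ (ξ i))) ξ n) (Set.Ici 0) := by
  set S : ℝ → ℂ := fun x => ∑ i ∈ Finset.range n, z * (m i * φ (ξ i)) * (ramp (ξ i) x : ℂ) with hS
  have hSc : Continuous S := by
    have := fun i => Complex.continuous_ofReal.comp (continuous_ramp (ξ i))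
    fun_prop
  -- Nothing is known about `φ` on the negative axis, and test functions do not see it; it is
  -- replaced by a continuous extension.
  have hφ : Continuous fun x => φ (max x 0) :=
    h.continuousOn.comp_continuous (by fun_prop) fun x => Set.mem_Ici.2 (le_max_right _ _)
  obtain ⟨c, hc⟩ := exists_eq_sum_pow_of_integral_iteratedDeriv_mul_eq_zero 3
    (ψ := fun x => φ (max x 0) + S x) (hφ.add hSc) fun η hη => by
      have e1 := h.weak_eq η hη.smooth hη.compact hη.supp
      have e2 : ∫ x, ((iteratedDeriv 3 η x : ℝ) : ℂ) * φ x =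
          ∫ x, ((iteratedDeriv 3 η x : ℝ) : ℂ) * φ (max x 0) := by
        congr 1
        ext x
        rcases le_or_gt x 0 with hx | hx
        · simp [(hη.isTest_iteratedDeriv 3).eq_zero hx]
        · rw [max_eq_left hx.le]
      have i1 := (hη.isTest_iteratedDeriv 3).integrable_mul hφ
      have i2 := (hη.isTest_iteratedDeriv 3).integrable_mul hSc
      simp only [mul_add]
      rw [integral_add i1 i2, ← e2, e1, integral_truncMeasure hm, hS, hη.integral_mul_sum_ramp,
        Finset.mul_sum, ← sub_eq_add_neg, ← Finset.sum_sub_distrib]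
      exact Finset.sum_eq_zero fun i _ => by ring
  have key : Set.EqOn φ (spline (c 0) (c 1) (2 * c 2) (fun i => z * (m i * φ (ξ i))) ξ n)
      (Set.Ioi 0) := fun x hx => by
    have := hc x hx
    rw [max_eq_left (le_of_lt hx), hS] at this
    simp only [Finset.sum_range_succ, Finset.sum_range_zero] at this
    rw [spline]
    linear_combination this
  exact ⟨_, _, _, key.of_subset_closure h.continuousOn continuous_spline.continuousOn
    Set.Ioi_subset_Ici_self (closure_Ioi (0 : ℝ)).ge⟩

include hξ0

theorem IsSolution.eqOn_spline (h : IsSolution (truncMeasure m ξ n) z φ) (h0 : φ 0 = 0)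
    (h1 : rightDeriv φ 0 = 0) :
    Set.EqOn φ (spline 0 0 (rightDeriv (rightDeriv φ) 0) (fun i => z * (m i * φ (ξ i))) ξ n)
      (Set.Ici 0) := by
  obtain ⟨A, B, C, H⟩ := h.exists_eqOn_spline hm
  have e0 := H Set.self_mem_Ici
  have e1 := rightDeriv_eqOn_splineDeriv H Set.self_mem_Ici
  have e2 := rightDeriv_rightDeriv_eqOn_splineDeriv2 H Set.self_mem_Ici
  rw [spline_zero hξ0, h0] at e0
  rw [splineDeriv_zero hξ0, h1] at e1
  rw [splineDeriv2_zero hξ0] at e2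
  rw [e2]
  subst e0 e1
  exact H

omit hm hξ0

/-- The solution of the initial value problem. -/
noncomputable def fundSol (m ξ : ℕ → ℝ) (n : ℕ) (z : ℂ) : ℝ → ℂ :=
  spline 0 0 1 (fun i => z * (m i * nodeValue m ξ z i)) ξ n

include hξ

theorem sum_ramp_node (d : ℕ → ℂ) {k : ℕ} (hk : k < n) :
    ∑ i ∈ Finset.range n, d i * (ramp (ξ i) (ξ k) : ℂ) =
      ∑ i ∈ Finset.range (k + 1), d i * (((ξ k : ℂ) - ξ i) ^ 2 / 2) := by
  rw [← Finset.sum_subset (Finset.range_subset_range.2 hk)]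
  · refine Finset.sum_congr rfl fun i hi => ?_
    rw [ramp_of_ge (hξ.monotone (Nat.lt_succ_iff.1 (Finset.mem_range.1 hi)))]
    push_cast
    ring
  · intro i _ hi
    rw [Finset.mem_range, not_lt] at hi
    rw [ramp_of_le (hξ.monotone (by omega)), Complex.ofReal_zero, mul_zero]

theorem fundSol_node {k : ℕ} (hk : k < n) : fundSol m ξ n z (ξ k) = nodeValue m ξ z k := by
  have := nodeValue_eq m ξ z k (ξ k)
  rw [fundSol, spline, sum_ramp_node hξ _ hk]
  linear_combination -this

/-- The spline formula refers to the unknown node values, but a ramp vanishes up to and including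
its own node. The system is therefore triangular, and strong induction solves it. -/
theorem eq_mul_nodeValue (h : Set.EqOn φ (spline 0 0 C (fun i => z * (m i * φ (ξ i))) ξ n)
    (Set.Ici 0)) (hξ0 : ∀ i, 0 < ξ i) {k : ℕ} (hk : k < n) :
    φ (ξ k) = C * nodeValue m ξ z k := by
  induction k using Nat.strong_induction_on with
  | _ k ih =>
    have := nodeValue_eq m ξ z k (ξ k)
    rw [h (hξ0 k).le, spline, sum_ramp_node hξ _ hk]
    rw [Finset.sum_range_succ] at this ⊢
    have e : ∑ i ∈ Finset.range k, z * (m i * φ (ξ i)) * (((ξ k : ℂ) - ξ i) ^ 2 / 2) =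
        C * ∑ i ∈ Finset.range k, z * (m i * nodeValue m ξ z i) * (((ξ k : ℂ) - ξ i) ^ 2 / 2) := by
      rw [Finset.mul_sum]
      refine Finset.sum_congr rfl fun i hi => ?_
      have hi := Finset.mem_range.1 hi
      rw [ih i hi (hi.trans hk)]
      ring
    rw [e]
    linear_combination -C * this

theorem eqOn_mul_fundSol (h : Set.EqOn φ (spline 0 0 C (fun i => z * (m i * φ (ξ i))) ξ n)
    (Set.Ici 0)) (hξ0 : ∀ i, 0 < ξ i) :
    Set.EqOn φ (fun x => C * fundSol m ξ n z x) (Set.Ici 0) := by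
  intro x hx
  rw [h hx]
  dsimp only
  rw [fundSol, spline, spline, mul_sub, Finset.mul_sum]
  have e : ∀ i ∈ Finset.range n, z * (m i * φ (ξ i)) * (ramp (ξ i) x : ℂ) =
      C * (z * (m i * nodeValue m ξ z i) * (ramp (ξ i) x : ℂ)) := fun i hi => by
    rw [eq_mul_nodeValue hξ h hξ0 (Finset.mem_range.1 hi)]; ring
  rw [Finset.sum_congr rfl e]
  ring

theorem fundSol_eq_spline : fundSol m ξ n z =
    spline 0 0 1 (fun i => z * (m i * fundSol m ξ n z (ξ i))) ξ n := by
  ext x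
  conv_lhs => rw [fundSol]
  rw [spline, spline]
  congr 1
  exact Finset.sum_congr rfl fun i hi => by rw [fundSol_node hξ (Finset.mem_range.1 hi)]

end Solution

end CubicString

/-! ### Functions in `L²` of the mass distribution. -/

namespace CubicString

open MeasureTheory

section Measure

variable {m ξ : ℕ → ℝ} {n : ℕ}

theorem truncMeasure_restrict (h : ∀ i < n, ξ i ∈ Set.Icc (0 : ℝ) 1) :
    (truncMeasure m ξ n).restrict (Set.Icc 0 1) = truncMeasure m ξ n := by
  refine Measure.restrict_eq_self_of_ae_mem ?_
  rw [ae_iff]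
  change truncMeasure m ξ n (Set.Icc 0 1)ᶜ = 0
  rw [truncMeasure, massMeasure, Measure.finsetSum_apply]
  refine Finset.sum_eq_zero fun i _ => ?_
  rw [Measure.smul_apply, Measure.dirac_apply' _ measurableSet_Icc.compl,
    Set.indicator_of_notMem (Set.notMem_compl_iff.2 (h i i.2)), smul_zero]

theorem truncMeasure_singleton_ne_zero (hm : ∀ i, 0 < m i) {k : ℕ} (hk : k < n) :
    truncMeasure m ξ n {ξ k} ≠ 0 := by
  rw [truncMeasure, massMeasure, Measure.finsetSum_apply]
  intro h
  have := (Finset.sum_eq_zero_iff.1 h) ⟨k, hk⟩ (Finset.mem_univ _)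
  simp at this
  exact absurd this (not_le.2 (hm k))

theorem eq_zero_of_ae_truncMeasure (hm : ∀ i, 0 < m i) {p : ℝ → Prop}
    (h : ∀ᵐ x ∂(truncMeasure m ξ n), p x) {k : ℕ} (hk : k < n) : p (ξ k) := by
  by_contra hp
  refine truncMeasure_singleton_ne_zero hm hk (measure_mono_null ?_ (ae_iff.1 h))
  rintro _ rfl
  exact hp

theorem memLp_truncMeasure {F : ℝ → ℂ} (s : Set ℝ) :
    MemLp F 2 ((truncMeasure m ξ n).restrict s) :=
  (memLp_two_iff_integrable_sq_norm
    (integrable_massMeasure _ _ F).aestronglyMeasurable.restrict).2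
    (integrable_massMeasure _ _ fun x => ‖F x‖ ^ 2).restrict

theorem coeFn_sum_smul_toLp {ι : Type*} {μ : Measure ℝ} {f : ι → ℝ → ℂ}
    (hf : ∀ j, MemLp (f j) 2 μ) (c : ι → ℂ) (s : Finset ι) :
    ⇑(∑ j ∈ s, c j • (hf j).toLp (f j)) =ᵐ[μ] fun x => ∑ j ∈ s, c j * f j x := by
  classical
  induction s using Finset.induction_on with
  | empty => simp only [Finset.sum_empty]; exact Lp.coeFn_zero ℂ 2 μ
  | insert a s ha ih =>
    rw [Finset.sum_insert ha]
    filter_upwards [Lp.coeFn_add (c a • (hf a).toLp (f a)) (∑ j ∈ s, c j • (hf j).toLp (f j)), ih,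
      Lp.coeFn_smul (c a) ((hf a).toLp (f a)), (hf a).coeFn_toLp] with x h1 h2 h3 h4
    rw [h1, Pi.add_apply, h2, h3, Pi.smul_apply, h4, Finset.sum_insert ha, smul_eq_mul]

/-- Every node has positive mass, so an identity almost everywhere holds at each node. A linear
relation in `L²` is thus a relation between the vectors of node values. -/
theorem linearIndependent_toLp (hm : ∀ i, 0 < m i) (hξI : ∀ i < n, ξ i ∈ Set.Icc (0 : ℝ) 1)
    {ι : Type*} [Fintype ι] {f : ι → ℝ → ℂ}
    (hf : ∀ j, MemLp (f j) 2 ((truncMeasure m ξ n).restrict (Set.Icc 0 1)))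
    (h : LinearIndependent ℂ fun j : ι => fun i : Fin n => f j (ξ i)) :
    LinearIndependent ℂ fun j => (hf j).toLp (f j) := by
  rw [Fintype.linearIndependent_iff] at h ⊢
  intro c hc
  refine h c ?_
  have h1 := coeFn_sum_smul_toLp hf c Finset.univ
  rw [hc] at h1
  have h2 := (Lp.coeFn_zero ℂ 2 _).symm.trans h1
  rw [truncMeasure_restrict hξI] at h2
  ext i
  have := eq_zero_of_ae_truncMeasure hm h2 i.2
  simpa using this.symm

end Measure

/-! ### Boundary values at `1`, spectra and type 2 eigenfunctions. -/

section Spectrum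

variable {m ξ : ℕ → ℝ} {k : ℕ} (hm : ∀ i, 0 < m i) (hξ0 : ∀ i, 0 < ξ i) (hξ : StrictMono ξ)
  (h1 : ξ k = 1)

include hξ h1

theorem rightDeriv_fundSol_one (z : ℂ) :
    rightDeriv (fundSol m ξ (k + 1) z) 1 = nodeSlope m ξ z k := by
  have := nodeSlope_eq m ξ z k (ξ k)
  rw [rightDeriv_eqOn_splineDeriv (φ := fundSol m ξ (k + 1) z) (fun x _ => rfl)
    (show (1 : ℝ) ∈ Set.Ici 0 by simp), ← h1, splineDeriv]
  have e : ∀ i ∈ Finset.range (k + 1), z * (m i * nodeValue m ξ z i) *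
      ((max (ξ k - ξ i) 0 : ℝ) : ℂ) = z * (m i * nodeValue m ξ z i) * ((ξ k : ℂ) - ξ i) :=
    fun i hi => by
      rw [max_eq_left (sub_nonneg.2 (hξ.monotone (Nat.lt_succ_iff.1 (Finset.mem_range.1 hi))))]
      push_cast
      ring
  rw [Finset.sum_congr rfl e]
  linear_combination -this

theorem rightDeriv_rightDeriv_fundSol_one (z : ℂ) :
    rightDeriv (rightDeriv (fundSol m ξ (k + 1) z)) 1 = nodeCurv m ξ z k := by
  rw [rightDeriv_rightDeriv_eqOn_splineDeriv2 (φ := fundSol m ξ (k + 1) z) (fun x _ => rfl)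
    (show (1 : ℝ) ∈ Set.Ici 0 by simp), ← h1, splineDeriv2, nodeCurv_eq]
  congr 1
  refine Finset.sum_congr rfl fun i hi => ?_
  rw [if_pos (hξ.monotone (Nat.lt_succ_iff.1 (Finset.mem_range.1 hi)))]
  simp


/-- The polynomials `φ(1; z)`, `φ_ξ(1; z)`, `φ_ξξ(1; z)`. -/
noncomputable def endPoly (m ξ : ℕ → ℝ) (k : ℕ) (a : Fin 3) : Polynomial ℝ :=
  match a with
  | 0 => (states m ξ k).1
  | 1 => (states m ξ k).2.1
  | 2 => (states m ξ k).2.2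

theorem endValue_fundSol (a : Fin 3) (z : ℂ) :
    endValue a (fundSol m ξ (k + 1) z) = Polynomial.aeval z (endPoly m ξ k a) := by
  fin_cases a
  · have := fundSol_node (m := m) (z := z) hξ (Nat.lt_succ_self k)
    rw [h1] at this
    exact this
  · exact rightDeriv_fundSol_one hξ h1 z
  · exact rightDeriv_rightDeriv_fundSol_one hξ h1 z

omit hξ h1

theorem endValue_of_eqOn_mul {n : ℕ} {z C : ℂ} {φ : ℝ → ℂ}
    (h : Set.EqOn φ (fun x => C * fundSol m ξ n z x) (Set.Ici 0)) (a : Fin 3) :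
    endValue a φ = C * endValue a (fundSol m ξ n z) := by
  have e1 := rightDeriv_eqOn h fun x => (hasDerivWithinAt_spline x).const_mul C
  have e2 := rightDeriv_eqOn e1 fun x => (hasDerivWithinAt_splineDeriv x).const_mul C
  have h1 : (1 : ℝ) ∈ Set.Ici 0 := Set.mem_Ici.2 zero_le_one
  have e3 := rightDeriv_eqOn_splineDeriv (φ := fundSol m ξ n z) (fun x _ => rfl) h1
  have e4 := rightDeriv_rightDeriv_eqOn_splineDeriv2 (φ := fundSol m ξ n z) (fun x _ => rfl) h1
  fin_cases a
  · exact h h1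
  · exact (e1 h1).trans (congrArg (C * ·) e3.symm)
  · exact (e2 h1).trans (congrArg (C * ·) e4.symm)

include hm hξ0 hξ

theorem isIVPSolution_fundSol (n : ℕ) (z : ℂ) :
    IsIVPSolution (truncMeasure m ξ n) z (fundSol m ξ n z) := by
  have h0 : (0 : ℝ) ∈ Set.Ici 0 := Set.self_mem_Ici
  refine ⟨isSolution_of_eqOn_spline (C := 1) hm fun x _ => ?_, spline_zero hξ0, ?_, ?_⟩
  · exact congrFun (fundSol_eq_spline hξ) x
  · rw [rightDeriv_eqOn_splineDeriv (φ := fundSol m ξ n z) (fun x _ => rfl) h0,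
      splineDeriv_zero hξ0]
  · rw [rightDeriv_rightDeriv_eqOn_splineDeriv2 (φ := fundSol m ξ n z) (fun x _ => rfl) h0,
      splineDeriv2_zero hξ0]

theorem IsSolution.eqOn_mul_fundSol {n : ℕ} {z : ℂ} {φ : ℝ → ℂ}
    (h : IsSolution (truncMeasure m ξ n) z φ) (h0 : φ 0 = 0) (h1 : rightDeriv φ 0 = 0) :
    Set.EqOn φ (fun x => rightDeriv (rightDeriv φ) 0 * fundSol m ξ n z x) (Set.Ici 0) :=
  CubicString.eqOn_mul_fundSol hξ (h.eqOn_spline hm hξ0 h0 h1) hξ0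

theorem IsEigenfunction.exists_eqOn {n : ℕ} {z : ℂ} {φ : ℝ → ℂ} {a : Fin 3}
    (h : IsEigenfunction (truncMeasure m ξ n) a z φ) :
    endValue a (fundSol m ξ n z) = 0 ∧
      ∃ C ≠ 0, Set.EqOn φ (fun x => C * fundSol m ξ n z x) (Set.Ici 0) := by
  have H := h.toIsSolution.eqOn_mul_fundSol hm hξ0 hξ h.zero h.deriv_zero
  have hC : rightDeriv (rightDeriv φ) 0 ≠ 0 := fun hC => by
    obtain ⟨x, hx, hne⟩ := h.ne_zero
    exact hne (by simpa only [hC, zero_mul] using H hx.1)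
  refine ⟨?_, _, hC, H⟩
  have := h.endValue_eq
  rw [endValue_of_eqOn_mul H a] at this
  exact (mul_eq_zero.1 this).resolve_left hC

theorem eigenvalues_eq {n : ℕ} (hn : 0 < n) (hξI : ∀ i < n, ξ i ∈ Set.Icc (0 : ℝ) 1) (a : Fin 3) :
    eigenvalues (truncMeasure m ξ n) a = {z | endValue a (fundSol m ξ n z) = 0} := by
  ext z
  refine ⟨fun ⟨φ, hφ⟩ => (hφ.exists_eqOn hm hξ0 hξ).1, fun hz => ?_⟩
  have H := isIVPSolution_fundSol hm hξ0 hξ n z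
  refine ⟨_, H.toIsSolution, H.zero, H.deriv_zero, hz, ξ 0, hξI 0 hn, ?_⟩
  -- Up to the first mass the solution is `x² / 2` for every `z`, so it is nonzero at `ξ 0`.
  rw [fundSol_node hξ hn, nodeValue_zero]
  simp [(hξ0 0).ne']

theorem eigenfunctions_proportional {n : ℕ} {a : Fin 3} {w : ℂ} {ψ χ : ℝ → ℂ}
    (hψ : IsEigenfunction (truncMeasure m ξ n) a w ψ)
    (hχ : IsEigenfunction (truncMeasure m ξ n) a w χ) :
    ∃ c : ℂ, Set.EqOn χ (fun x => c * ψ x) (Set.Icc 0 1) := by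
  obtain ⟨-, C, hC, h⟩ := hψ.exists_eqOn hm hξ0 hξ
  obtain ⟨-, D, -, h'⟩ := hχ.exists_eqOn hm hξ0 hξ
  refine ⟨D / C, fun x hx => ?_⟩
  dsimp only
  rw [h' hx.1, h hx.1]
  dsimp only
  field_simp

include h1

/-- The spectrum, from the roots of the characteristic polynomial. -/
theorem spectrum_of_endPoly_eq {a : Fin 3} {A : ℝ} (hA : 0 < A) {s : ℕ → ℝ} {N : ℕ}
    (hs : ∀ i < N, 0 < s i) (hinj : ∀ i < N, ∀ j < N, i < j → s i < s j)
    (hP : endPoly m ξ k a = rootPoly A s N) :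
    eigenvalues (truncMeasure m ξ (k + 1)) a = Set.range (fun j : Fin N => (s j : ℂ)) ∧
    (eigenvalues (truncMeasure m ξ (k + 1)) a).encard = N ∧
    ∀ w ∈ eigenvalues (truncMeasure m ξ (k + 1)) a, w.im = 0 ∧ 0 < w.re ∧
      analyticOrderAt (fun z => endValue a (fundSol m ξ (k + 1) z)) w = 1 := by
  have hξI : ∀ i < k + 1, ξ i ∈ Set.Icc (0 : ℝ) 1 := fun i hi =>
    ⟨(hξ0 i).le, h1 ▸ hξ.monotone (Nat.lt_succ_iff.1 hi)⟩
  have hne : ∀ i < N, ∀ j < N, j ≠ i → s j ≠ s i := fun i hi j hj hij =>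
    (lt_or_gt_of_ne hij).elim (fun h => (hinj j hj i hi h).ne) fun h => (hinj i hi j hj h).ne'
  have hr : eigenvalues (truncMeasure m ξ (k + 1)) a =
      Set.range (fun j : Fin N => (s j : ℂ)) := by
    rw [eigenvalues_eq hm hξ0 hξ (Nat.succ_pos k) hξI]
    ext z
    rw [Set.mem_ofPred_eq, endValue_fundSol hξ h1, hP, aeval_rootPoly_eq_zero_iff hA]
    constructor
    · rintro ⟨i, hi, rfl⟩
      exact ⟨⟨i, hi⟩, rfl⟩
    · rintro ⟨i, rfl⟩
      exact ⟨i, i.2, rfl⟩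
  have hi : Function.Injective (fun j : Fin N => (s j : ℂ)) := fun i j hij => by
    by_contra h
    exact hne j j.2 i i.2 (fun h' => h (Fin.ext h')) (Complex.ofReal_injective hij)
  refine ⟨hr, by
    rw [hr, ← Set.image_univ, hi.encard_image, Set.encard_univ]; simp, fun w hw => ?_⟩
  rw [hr] at hw
  obtain ⟨i, rfl⟩ := hw
  refine ⟨Complex.ofReal_im _, by simpa using hs i i.2, ?_⟩
  simp only [endValue_fundSol hξ h1, hP]
  exact analyticOrderAt_rootPoly hA i.2 fun j hj hij => hne i i.2 j hj hij

omit hm in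
theorem form_fundSol (hm : ∀ i, 0 < m i) {z w : ℂ} (hzw : z + w ≠ 0)
    (hz : endValue 2 (fundSol m ξ (k + 1) z) = 0) (hw : endValue 2 (fundSol m ξ (k + 1) w) = 0) :
    form (truncMeasure m ξ (k + 1)) (fundSol m ξ (k + 1) z) (fundSol m ξ (k + 1) w) =
      rightDeriv (fundSol m ξ (k + 1) z) 1 * rightDeriv (fundSol m ξ (k + 1) w) 1 / (z + w) := by
  have hz : nodeCurv m ξ z k = 0 := (endValue_fundSol hξ h1 2 z).symm.trans hz
  have hw : nodeCurv m ξ w k = 0 := (endValue_fundSol hξ h1 2 w).symm.trans hw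
  have hL := sum_nodeValue_mul_nodeValue m ξ z w k
  rw [hz, hw] at hL
  rw [form, truncMeasure_restrict fun i hi => ⟨(hξ0 i).le, h1 ▸ hξ.monotone (Nat.lt_succ_iff.1 hi)⟩,
    integral_truncMeasure hm, rightDeriv_fundSol_one hξ h1, rightDeriv_fundSol_one hξ h1,
    eq_div_iff hzw]
  have e : ∀ i ∈ Finset.range (k + 1), (m i : ℂ) * (fundSol m ξ (k + 1) z (ξ i) *
      fundSol m ξ (k + 1) w (ξ i)) = m i * (nodeValue m ξ z i * nodeValue m ξ w i) :=
    fun i hi => by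
      rw [fundSol_node hξ (Finset.mem_range.1 hi), fundSol_node hξ (Finset.mem_range.1 hi)]
  rw [Finset.sum_congr rfl e]
  linear_combination hL

omit hm in
/-- The eigenfunctions of type 2 are eigenvectors of the Green's operator. -/
theorem linearIndependent_fundSol {ι : Type*} {z : ι → ℂ} (hz : Function.Injective z)
    (hz0 : ∀ j, z j ≠ 0) (he : ∀ j, endValue 2 (fundSol m ξ (k + 1) (z j)) = 0) :
    LinearIndependent ℂ fun j => fun i : Fin (k + 1) => fundSol m ξ (k + 1) (z j) (ξ i) := by
  -- The condition `φ_ξξ(1) = 0` reads `1 = z ∑ m_i φ(ξ_i)`. Substituting this for the coefficient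
  -- of `x² / 2` in the spline formula gives `φ = z G φ` at the nodes, hence the eigenvalue `1 / z`.
  let G : Matrix (Fin (k + 1)) (Fin (k + 1)) ℂ := fun l i =>
    m i * ((ξ l : ℂ) ^ 2 / 2 - (ramp (ξ i) (ξ l) : ℂ))
  refine Module.End.eigenvectors_linearIndependent' (Matrix.toLin' G) (fun j => (z j)⁻¹)
    (inv_injective.comp hz) _ fun j => ⟨Module.End.mem_eigenspace_iff.2 ?_, fun h => ?_⟩
  · ext l
    have h2 := he j
    rw [endValue_fundSol hξ h1] at h2
    have h3 : nodeCurv m ξ (z j) k = 0 := h2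
    rw [nodeCurv_eq] at h3
    rw [Matrix.toLin'_apply, Matrix.mulVec, dotProduct, Pi.smul_apply, smul_eq_mul,
      eq_inv_mul_iff_mul_eq₀ (hz0 j)]
    have e : ∑ i : Fin (k + 1), G l i * fundSol m ξ (k + 1) (z j) (ξ i) =
        ∑ i ∈ Finset.range (k + 1), m i * ((ξ l : ℂ) ^ 2 / 2 - (ramp (ξ i) (ξ l) : ℂ)) *
          nodeValue m ξ (z j) i := by
      rw [Finset.sum_range]
      exact Finset.sum_congr rfl fun i _ => by rw [fundSol_node hξ i.2]
    rw [e, fundSol, spline, Finset.mul_sum]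
    have e' : ∑ i ∈ Finset.range (k + 1), z j * (m i * ((ξ l : ℂ) ^ 2 / 2 -
          (ramp (ξ i) (ξ l) : ℂ)) * nodeValue m ξ (z j) i) =
        (ξ l : ℂ) ^ 2 / 2 * ∑ i ∈ Finset.range (k + 1), z j * (m i * nodeValue m ξ (z j) i) -
        ∑ i ∈ Finset.range (k + 1), z j * (m i * nodeValue m ξ (z j) i) *
          (ramp (ξ i) (ξ l) : ℂ) := by
      rw [Finset.mul_sum, ← Finset.sum_sub_distrib]
      exact Finset.sum_congr rfl fun i _ => by ring
    rw [e']
    linear_combination -((ξ l : ℂ) ^ 2 / 2) * h3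
  · have h4 := congrFun h ⟨0, Nat.succ_pos k⟩
    simp only [Pi.zero_apply] at h4
    rw [fundSol_node hξ (Nat.succ_pos k), nodeValue_zero] at h4
    have : (ξ 0 : ℂ) ≠ 0 := by exact_mod_cast (hξ0 0).ne'
    exact this (by simpa using h4)

end Spectrum

/-- The first terms of an infinite sequence with a prescribed tail. -/
def extend {n : ℕ} (f : Fin n → ℝ) (t : ℕ → ℝ) (i : ℕ) : ℝ := if h : i < n then f ⟨i, h⟩ else t i

theorem extend_val {n : ℕ} (f : Fin n → ℝ) (t : ℕ → ℝ) (i : Fin n) : extend f t i = f i := by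
  simp [extend]

theorem massMeasure_eq_truncMeasure {n : ℕ} (m ξ : Fin n → ℝ) (t u : ℕ → ℝ) :
    massMeasure m ξ = truncMeasure (extend m t) (extend ξ u) n := by
  simp only [truncMeasure, extend_val]

end CubicString

/-! ### Assembly of the theorem. -/

theorem mainTheorem5 (n : ℕ) (hn : 1 ≤ n) (m ξ : Fin n → ℝ)
    (hm : ∀ i, 0 < m i) (hξpos : ∀ i, 0 < ξ i) (hξ : StrictMono ξ)
    (hlast : ξ ⟨n - 1, by omega⟩ = 1) :
    -- the solution `φ z` of the initial value problem exists and is unique on `[0, ∞)`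
    ∃ φ : ℂ → ℝ → ℂ,
      (∀ z, CubicString.IsIVPSolution (CubicString.massMeasure m ξ) z (φ z)) ∧
      (∀ z ψ, CubicString.IsIVPSolution (CubicString.massMeasure m ξ) z ψ →
        Set.EqOn ψ (φ z) (Set.Ici 0)) ∧
      -- the spectra are positive and simple (one-dimensional eigenspaces, and simple zeros of
      -- the characteristic function)
      (∀ a : Fin 3, ∀ w ∈ CubicString.eigenvalues (CubicString.massMeasure m ξ) a,
        w.im = 0 ∧ 0 < w.re ∧
        (∀ ψ χ, CubicString.IsEigenfunction (CubicString.massMeasure m ξ) a w ψ →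
          CubicString.IsEigenfunction (CubicString.massMeasure m ξ) a w χ →
          ∃ c : ℂ, Set.EqOn χ (fun x => c * ψ x) (Set.Icc 0 1)) ∧
        analyticOrderAt (fun z => CubicString.endValue a (φ z)) w = 1) ∧
      -- the spectra are the zero sets of the characteristic functions
      (∀ a : Fin 3, CubicString.eigenvalues (CubicString.massMeasure m ξ) a =
        {z | CubicString.endValue a (φ z) = 0}) ∧
      -- cardinalities
      (CubicString.eigenvalues (CubicString.massMeasure m ξ) 0).encard = (n - 1 : ℕ) ∧
      (CubicString.eigenvalues (CubicString.massMeasure m ξ) 1).encard = (n - 1 : ℕ) ∧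
      (CubicString.eigenvalues (CubicString.massMeasure m ξ) 2).encard = n ∧
      -- enumeration and interlacing
      ∃ (z₀ z₁ : Fin (n - 1) → ℝ) (z₂ : Fin n → ℝ),
        CubicString.eigenvalues (CubicString.massMeasure m ξ) 0 =
          Set.range (fun j => (z₀ j : ℂ)) ∧
        CubicString.eigenvalues (CubicString.massMeasure m ξ) 1 =
          Set.range (fun j => (z₁ j : ℂ)) ∧
        CubicString.eigenvalues (CubicString.massMeasure m ξ) 2 =
          Set.range (fun j => (z₂ j : ℂ)) ∧
        0 < z₂ ⟨0, by omega⟩ ∧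
        (∀ j : Fin (n - 1), z₂ ⟨j, by omega⟩ < z₁ j ∧ z₁ j < z₀ j ∧
          z₀ j < z₂ ⟨j + 1, by omega⟩) ∧
        -- factorization for the type 2 eigenfunctions
        (∀ i j : Fin n,
          CubicString.form (CubicString.massMeasure m ξ) (φ (z₂ i)) (φ (z₂ j)) =
            CubicString.rightDeriv (φ (z₂ i)) 1 * CubicString.rightDeriv (φ (z₂ j)) 1 /
              ((z₂ i : ℂ) + (z₂ j : ℂ))) ∧
        -- linear independence in the space `L²` of `g` on `[0, 1]`
        ∃ hL : ∀ j : Fin n, MeasureTheory.MemLp (φ (z₂ j)) 2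
            ((CubicString.massMeasure m ξ).restrict (Set.Icc 0 1)),
          LinearIndependent ℂ (fun j : Fin n => (hL j).toLp (φ (z₂ j))) := by
  open CubicString in
  obtain ⟨k, rfl⟩ : ∃ k, n = k + 1 := ⟨n - 1, by omega⟩
  -- Masses `1` at positions `1 + i` prolong the data to infinite sequences, keeping positivity and
  -- strict monotonicity for all indices; the truncated measure ignores them.
  rw [massMeasure_eq_truncMeasure m ξ (fun _ => 1) (fun i => 1 + i)]
  have hm' : ∀ i, 0 < extend m (fun _ => 1) i := fun i => by
    unfold extend
    split_ifs
    exacts [hm _, one_pos]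
  have hξ0 : ∀ i, 0 < extend ξ (fun i => 1 + i) i := fun i => by
    unfold extend
    split_ifs
    exacts [hξpos _, by positivity]
  have hξ' : StrictMono (extend ξ (fun i => 1 + i)) := strictMono_nat_of_lt_succ fun i => by
    unfold extend
    split_ifs with h h' h'
    · exact hξ (Fin.mk_lt_mk.2 (Nat.lt_succ_self i))
    · refine (hξ.monotone (b := ⟨k + 1 - 1, by omega⟩) (Fin.mk_le_mk.2 (by omega))).trans_lt ?_
      rw [hlast]
      push_cast
      linarith [i.cast_nonneg (α := ℝ)]
    · omega
    · push_cast
      linarith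
  have hlast' : extend ξ (fun i => 1 + i) k = 1 := by
    rw [← hlast]
    exact extend_val ξ _ ⟨k, by omega⟩
  clear hlast hξ hξpos hm
  generalize extend m (fun _ => 1) = m at hm'
  generalize extend ξ (fun i => 1 + i) = ξ at hξ0 hξ' hlast'
  have hξI : ∀ i < k + 1, ξ i ∈ Set.Icc (0 : ℝ) 1 := fun i hi =>
    ⟨(hξ0 i).le, hlast' ▸ hξ'.monotone (Nat.lt_succ_iff.1 hi)⟩
  obtain ⟨a, b, c, H⟩ := exists_interlacing_states hm' (hξ0 0) hξ' k
  obtain ⟨A, hA, hr⟩ := H.hr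
  obtain ⟨B, hB, hq⟩ := H.hq
  obtain ⟨D, hD, hp⟩ := H.hp
  have ha : ∀ i ≤ k, 0 < a i := fun i hi => H.pos.trans_le (H.mono (Nat.zero_le i) hi)
  -- Types 0, 1, 2 belong to `p`, `q`, `r` with roots `c`, `b`, `a`. As `k` is the index of the last
  -- mass, they have `k`, `k` and `k + 1` points.
  obtain ⟨r0, n0, p0⟩ := spectrum_of_endPoly_eq (a := 0) hm' hξ0 hξ' hlast' hD
    (fun i hi => by linarith [ha i hi.le, H.lt i hi])
    (fun i hi j hj hij => by linarith [H.lt i hi, H.mono (i := i + 1) hij hj.le, H.lt j hj]) hp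
  obtain ⟨r1, n1, p1⟩ := spectrum_of_endPoly_eq (a := 1) hm' hξ0 hξ' hlast' hB
    (fun i hi => by linarith [ha i hi.le, H.lt i hi])
    (fun i hi j hj hij => by linarith [H.lt i hi, H.mono (i := i + 1) hij hj.le, H.lt j hj]) hq
  have hamono : ∀ i < k + 1, ∀ j < k + 1, i < j → a i < a j := fun i hi j hj hij => by
    linarith [H.lt i (by omega), H.mono (i := i + 1) hij (by omega)]
  obtain ⟨r2, n2, p2⟩ := spectrum_of_endPoly_eq (a := 2) hm' hξ0 hξ' hlast' hA
    (fun i hi => ha i (by omega)) hamono hr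
  have he : ∀ j : Fin (k + 1), endValue 2 (fundSol m ξ (k + 1) (a j)) = 0 := fun j => by
    have : (a j : ℂ) ∈ eigenvalues (truncMeasure m ξ (k + 1)) 2 := r2 ▸ ⟨j, rfl⟩
    rwa [eigenvalues_eq hm' hξ0 hξ' k.succ_pos hξI] at this
  refine ⟨fundSol m ξ (k + 1), isIVPSolution_fundSol hm' hξ0 hξ' _, fun z ψ hψ x hx => ?_, ?_,
    eigenvalues_eq hm' hξ0 hξ' k.succ_pos hξI, n0, n1, n2, fun j => c j, fun j => b j,
    fun j => a j, r0, r1, r2, H.pos, fun j => ?_, fun i j => ?_,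
    fun j => memLp_truncMeasure _, ?_⟩
  · have := hψ.toIsSolution.eqOn_mul_fundSol hm' hξ0 hξ' hψ.zero hψ.deriv_zero hx
    simpa only [hψ.deriv2_zero, one_mul] using this
  · intro t w hw
    have key : w.im = 0 ∧ 0 < w.re ∧
        analyticOrderAt (fun z => endValue t (fundSol m ξ (k + 1) z)) w = 1 := by
      fin_cases t
      exacts [p0 w hw, p1 w hw, p2 w hw]
    exact ⟨key.1, key.2.1, fun ψ χ => eigenfunctions_proportional hm' hξ0 hξ', key.2.2⟩
  · exact H.lt j j.2
  · refine form_fundSol hξ0 hξ' hlast' hm' ?_ (he i) (he j)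
    have h1 := ha i (by omega)
    have h2 := ha j (by omega)
    exact_mod_cast (add_pos h1 h2).ne'
  · refine linearIndependent_toLp hm' hξI _ (linearIndependent_fundSol hξ0 hξ' hlast' ?_ ?_ he)
    · intro i j hij
      have hij : a i = a j := Complex.ofReal_injective hij
      rcases lt_trichotomy i j with h | h | h
      · exact absurd hij (hamono i i.2 j j.2 h).ne
      · exact h
      · exact absurd hij (hamono j j.2 i i.2 h).ne'
    · intro j
      exact_mod_cast (ha j (by omega)).ne'
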